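/- **Conventions.** A *hypergraph* is a triple $H=(V,E,i)$ with finite sets $V=V(H)$, $E=E(H)$ and a map $i:E\to 2^V$ with $|i(e)|\ge 2$ for all $e\in E$ (parallel edges are allowed). A *subhypergraph* is given by $V'\subseteq V$ and $E'\subseteq E$ with $i(e)\subseteq V'$ for all $e\in E'$, with $i$ restricted to $E'$. For $X\subseteq V$, $H[X]$ is the subhypergraph with vertex set $X$ and edge set $\{e: i(e)\subseteq X\}$, and $H-v=H[V\setminus\{v\}]$. The degree $d_H(v)$ is the number of edges $e$ with $v\in i(e)$; $\delta(H)$ and $\Delta(H)$ are the minimum and maximum degree (both $0$ if $V=\varnothing$); $H$ is *$r$-regular* if it is non-empty and all its degrees are $r$. $H$ is *connected* if it is non-empty and any two vertices are joined by a hyperpath, i.e. a sequence $(v_1,e_1,v_2,\dots,e_q,v_{q+1})$ of distinct vertices and distinct edges with $\{v_j,v_{j+1}\}\subseteq i(e_j)$. A vertex $v$ of $H$ is *separating* if $H$ is the union of two induced subhypergraphs, each with at least two vertices, whose only common vertex is $v$. A *block* of $H$ is a maximal connected subhypergraph of $H$ that itself has no separating vertex. A *brick* is a hypergraph isomorphic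 to $tC_n$ with $t\ge1$ and $n\ge3$ odd, or to $tK_n$ with $t,n\ge1$, where $C_n$ is the cycle and $K_n$ the complete graph on $n$ vertices and $tG$ arises from $G$ by replacing each edge by $t$ parallel edges. A *hypergraph property* $\mathcal P$ is an isomorphism-closed class of hypergraphs. It is *non-trivial* if it contains a non-empty hypergraph but not all hypergraphs, *hereditary* if it is closed under induced subhypergraphs, and *additive* if it is closed under vertex-disjoint unions. Let $\mathcal F(\mathcal P)$ be the class of hypergraphs $H\notin\mathcal P$ such that $H-v\in\mathcal P$ for all $v\in V(H)$, and let $d(\mathcal P)=\min\{\delta(H): H\in\mathcal F(\mathcal P)\}$. Given a set $C$ of colors and lists $L:V(H)\to 2^C$, $H$ is *$(\mathcal P,L)$-colorable* if there is $\varphi:V(H)\to C$ with $\varphi(v)\in L(v)$ for all $v\in V(H)$ and $H[\varphi^{-1}(c)]\in\mathcal P$ for all $c\in C$. **Theorem.** Let $\mathcal P$ be a non-trivial, hereditary and additive hypergraph property with $d(\mathcal P)=r$, let $H$ be a connected hypergraph, and let $L$ be a list-assignment for $H$ with $r|L(v)|\ge d_H(v)$ for all $v\in V(H)$. Then $H$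 is $(\mathcal P,L)$-colorable, unless every block $B$ of $H$ satisfies at least one of the following: $B$ is a brick; or $B\in\mathcal F(\mathcal P)$ and $B$ is $r$-regular; or $B\in\mathcal P$ and $\Delta(B)\le r$. -/

import Mathlib

universe u v w

/-- A finite, undirected, loopless hypergraph that may have parallel edges: a triple `(V, E, i)`
of finite `V`, `E` and an incidence function `i : E → 2^V` with `|i e| ≥ 2` for every edge.
(Mathlib's `Hypergraph` has no parallel edges.) -/
structure MultiHypergraph : Type (u + 1) where
  V : Type u
  E : Type u
  finite_V : Finite V
  finite_E : Finite E
  inc : E → Set V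
  two_le_inc : ∀ e, 2 ≤ (inc e).ncard

namespace MultiHypergraph

attribute [instance] finite_V finite_E

/-- Isomorphism of hypergraphs. -/
structure Iso (H : MultiHypergraph.{u}) (K : MultiHypergraph.{v}) where
  onV : H.V ≃ K.V
  onE : H.E ≃ K.E
  inc_eq : ∀ e, K.inc (onE e) = onV '' H.inc e

/-- A subhypergraph of `H`: a set of vertices and a set of edges all of whose incident vertices
are among those vertices. -/
@[ext]
structure Sub (H : MultiHypergraph.{u}) where
  verts : Set H.V
  edges : Set H.E
  inc_subset : ∀ e ∈ edges, H.inc e ⊆ verts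

/-- The relation "is a subhypergraph of" between subhypergraphs of `H`. -/
instance (H : MultiHypergraph.{u}) : LE H.Sub :=
  ⟨fun A B => A.verts ⊆ B.verts ∧ A.edges ⊆ B.edges⟩

/-- A subhypergraph regarded as a hypergraph. -/
def Sub.toHypergraph {H : MultiHypergraph.{u}} (A : H.Sub) : MultiHypergraph.{u} where
  V := A.verts
  E := A.edges
  finite_V := inferInstance
  finite_E := inferInstance
  inc e := Subtype.val ⁻¹' H.inc e.1
  two_le_inc e := by
    rw [Set.ncard_preimage_of_injective_subset_range Subtype.val_injective
      (by simpa using A.inc_subset e.1 e.2)]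
    exact H.two_le_inc e.1

/-- The induced subhypergraph on the vertex set `X`, as a subhypergraph: it has all the edges `e`
with `i e ⊆ X`. -/
def inducedSub (H : MultiHypergraph.{u}) (X : Set H.V) : H.Sub where
  verts := X
  edges := {e | H.inc e ⊆ X}
  inc_subset _ he := he

/-- The induced subhypergraph `H[X]`. -/
def induce (H : MultiHypergraph.{u}) (X : Set H.V) : MultiHypergraph.{u} :=
  (H.inducedSub X).toHypergraph

/-- `H - x`. -/
def deleteVertex (H : MultiHypergraph.{u}) (x : H.V) : MultiHypergraph.{u} :=
  H.induce {x}ᶜ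

/-- The degree of a vertex: the number of edges incident to it. -/
noncomputable def degree (H : MultiHypergraph.{u}) (x : H.V) : ℕ :=
  {e : H.E | x ∈ H.inc e}.ncard

/-- The minimum degree; it is `0` for the empty hypergraph. -/
noncomputable def minDegree (H : MultiHypergraph.{u}) : ℕ := ⨅ x, H.degree x

/-- The maximum degree; it is `0` for the empty hypergraph. -/
noncomputable def maxDegree (H : MultiHypergraph.{u}) : ℕ := ⨆ x, H.degree x

/-- `H` is non-empty and all its vertices have degree `r`. -/
def IsRegular (H : MultiHypergraph.{u}) (r : ℕ) : Prop :=
  Nonempty H.V ∧ ∀ x, H.degree x = r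

/-- There is a hyperpath `(v₀, e₀, v₁, …, e_{q-1}, v_q)` with distinct vertices, distinct edges and
`{v_i, v_{i+1}} ⊆ i (e_i)`, from `x` to `y`. -/
def HyperpathBetween (H : MultiHypergraph.{u}) (x y : H.V) : Prop :=
  ∃ (q : ℕ) (p : Fin (q + 1) → H.V) (e : Fin q → H.E),
    Function.Injective p ∧ Function.Injective e ∧
    (∀ j : Fin q, p j.castSucc ∈ H.inc (e j) ∧ p j.succ ∈ H.inc (e j)) ∧
    p 0 = x ∧ p (Fin.last q) = y

/-- A hypergraph is connected if it is non-empty and any two vertices are joined by a hyperpath. -/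
def Connected (H : MultiHypergraph.{u}) : Prop :=
  Nonempty H.V ∧ ∀ x y, H.HyperpathBetween x y

/-- `x` is a separating vertex: `H` is the union of two induced subhypergraphs `H[X]`, `H[Y]`, each
with at least two vertices, whose only common vertex is `x`. -/
def IsSeparatingVertex (H : MultiHypergraph.{u}) (x : H.V) : Prop :=
  ∃ X Y : Set H.V,
    (H.inducedSub X).verts ∪ (H.inducedSub Y).verts = Set.univ ∧
    (H.inducedSub X).edges ∪ (H.inducedSub Y).edges = Set.univ ∧
    X ∩ Y = {x} ∧ 2 ≤ X.ncard ∧ 2 ≤ Y.ncard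

/-- A block of `H` is a maximal connected subhypergraph of `H` that has no separating vertex. -/
def IsBlock {H : MultiHypergraph.{u}} (B : H.Sub) : Prop :=
  Maximal (fun A : H.Sub => A.toHypergraph.Connected ∧
    ¬ ∃ x, A.toHypergraph.IsSeparatingVertex x) B

/-- A finite simple graph as a hypergraph. -/
def ofSimpleGraph {V : Type u} [Finite V] (G : SimpleGraph V) : MultiHypergraph.{u} where
  V := V
  E := G.edgeSet
  finite_V := inferInstance
  finite_E := inferInstance
  inc e := {x | x ∈ e.1}
  two_le_inc := by
    rintro ⟨e, he⟩
    induction e using Sym2.ind with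
    | _ a b =>
      have hab : a ≠ b := G.ne_of_adj (by simpa using he)
      have hs : {x | x ∈ s(a, b)} = ({a, b} : Set V) := by
        ext x
        simp
      show 2 ≤ ({x | x ∈ s(a, b)} : Set V).ncard
      rw [hs, Set.ncard_pair hab]

/-- `tH`: every edge of `H` is replaced by `t` parallel edges. -/
def replicate (t : ℕ) (H : MultiHypergraph.{u}) : MultiHypergraph.{u} where
  V := H.V
  E := H.E × Fin t
  finite_V := inferInstance
  finite_E := inferInstance
  inc e := H.inc e.1
  two_le_inc e := H.two_le_inc e.1

/-- A brick: `tC_n` with `t ≥ 1` and `n ≥ 3` odd, or `tK_n` with `t, n ≥ 1`. -/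
def IsBrick (H : MultiHypergraph.{u}) : Prop :=
  (∃ t n : ℕ, 1 ≤ t ∧ 3 ≤ n ∧ Odd n ∧
    Nonempty (Iso H (replicate t (ofSimpleGraph (SimpleGraph.cycleGraph n))))) ∨
  (∃ t n : ℕ, 1 ≤ t ∧ 1 ≤ n ∧
    Nonempty (Iso H (replicate t (ofSimpleGraph (SimpleGraph.completeGraph (Fin n))))))

/-- The vertex-disjoint union of two hypergraphs. -/
def disjUnion (H K : MultiHypergraph.{u}) : MultiHypergraph.{u} where
  V := H.V ⊕ K.V
  E := H.E ⊕ K.E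
  finite_V := inferInstance
  finite_E := inferInstance
  inc := Sum.elim (fun e => Sum.inl '' H.inc e) (fun e => Sum.inr '' K.inc e)
  two_le_inc := by
    rintro (e | e)
    · simpa [Set.ncard_image_of_injective _ Sum.inl_injective] using H.two_le_inc e
    · simpa [Set.ncard_image_of_injective _ Sum.inr_injective] using K.two_le_inc e

end MultiHypergraph

/-- A hypergraph property: an isomorphism-closed class of hypergraphs. -/
structure HypergraphProperty : Type (u + 1) where
  carrier : Set MultiHypergraph.{u}
  iso_closed : ∀ H K : MultiHypergraph.{u}, Nonempty (H.Iso K) → H ∈ carrier → K ∈ carrier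

namespace HypergraphProperty

/-- Closed under induced subhypergraphs. -/
def Hereditary (P : HypergraphProperty.{u}) : Prop :=
  ∀ H ∈ P.carrier, ∀ X : Set H.V, H.induce X ∈ P.carrier

/-- `P` contains a non-empty hypergraph, but not all hypergraphs. -/
def NonTrivial (P : HypergraphProperty.{u}) : Prop :=
  (∃ H ∈ P.carrier, Nonempty H.V) ∧ ∃ H, H ∉ P.carrier

/-- Closed under vertex-disjoint unions. -/
def Additive (P : HypergraphProperty.{u}) : Prop :=
  ∀ H ∈ P.carrier, ∀ K ∈ P.carrier, H.disjUnion K ∈ P.carrier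

/-- `F(P)`: the hypergraphs `H ∉ P` with `H - x ∈ P` for all vertices `x`. -/
def forbidden (P : HypergraphProperty.{u}) : Set MultiHypergraph.{u} :=
  {H | H ∉ P.carrier ∧ ∀ x, H.deleteVertex x ∈ P.carrier}

/-- `d(P)`: the minimum of `δ(H)` over `H ∈ F(P)`. (For `P` hereditary and non-trivial `F(P)` is
non-empty, so that this is a minimum.) -/
noncomputable def d (P : HypergraphProperty.{u}) : ℕ :=
  sInf (MultiHypergraph.minDegree '' P.forbidden)

/-- `H` is `(P, L)`-colorable: vertices can be colored from their lists such that every color class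
induces a hypergraph in `P`. -/
def ListColorable (P : HypergraphProperty.{u}) (H : MultiHypergraph.{u}) {C : Type w}
    (L : H.V → Set C) : Prop :=
  ∃ φ : H.V → C, (∀ x, φ x ∈ L x) ∧ ∀ c, H.induce (φ ⁻¹' {c}) ∈ P.carrier

end HypergraphProperty

/-! Suppose that `H` has no coloring. The property enters the recoloring argument through one fact:
a color class stays in `P` when it gains a vertex of degree less than `r` in the enlarged class
(`Hereditary.degreeClosed`). Coloring greedily towards a root leaves only the root vacant
(`exists_almostColoring`). If `x` is the only vacant vertex, every color of `L x` has at least `r`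
edges at `x` that are monochromatic in it apart from `x`, since otherwise `x` could be colored. As
the degree of `x` is at most `r` times the length of its list, there are exactly `r` such edges per
color, and they exhaust the edges at `x` (`monoEdges_of_forall_le`). Hence the color of any neighbor
can be moved to `x`, as in a sliding puzzle, and the number of edges at the vacant `x` that are
monochromatic in `c` depends only on `x` and `c` (`monoSystem_almostColorings`). This survives in a
block when the coloring outside is frozen, since an edge outside the block meets it in at most one
vertex (`MonoSystem.restrict`).

Inside a block `B` there are two cases (`MonoSystem.isBrick_or_const`). If some vacant vertex sees a
single color `c`, balance makes this true whenever that vertex is vacant, and the absence of cut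
vertices spreads it to all vertices, so that `B - x` has only the color `c` whenever `x` is vacant.
Then all degrees in `B` are at most `r` and all `B - x` are in `P`; if `B` itself is not, it is in
`F(P)` and has minimum degree at least `r` (`IsBlock.mem_or_mem_of_const`).

Otherwise a vacant vertex always sees two colors. A detour that leaves an edge with three or more
vertices and returns to it would spoil its monochromaticity, so all edges of `B` have size two.
Rotating the vacancy around induced cycles forces the colors there to alternate; an induced cycle on
which the vacant vertex sees two colors is odd, and spanning if it is not a triangle. If only
triangles occur, exchanging colors within them shows that the graph is complete. The same
comparisons make the multiplicities constant (`BalancedSystem.classification`), so `B` is a brick.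
-/

open Function

/-! ### Sliding a vacancy along paths -/

/-- `S` is a set of configurations, each with at most one vacant vertex, that is closed under sliding
the vacancy along an edge of `G`. -/
structure SlidingSystem {V : Type u} {C : Type w} [DecidableEq V] (G : SimpleGraph V)
    (S : Set (V → Option C)) : Prop where
  unique : ∀ Φ ∈ S, ∀ x y, Φ x = none → Φ y = none → x = y
  slide : ∀ Φ ∈ S, ∀ x y, Φ x = none → G.Adj x y → Φ ∘ Equiv.swap x y ∈ S

/-- A path of `G` that is given by its sequence of vertices. -/
structure IsVertexPath {V : Type u} (G : SimpleGraph V) (m : ℕ) (p : ℕ → V) : Prop where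
  inj : ∀ i j, i ≤ m → j ≤ m → p i = p j → i = j
  adj : ∀ i < m, G.Adj (p i) (p (i + 1))

theorem SimpleGraph.Walk.IsPath.isVertexPath {V : Type u} {G : SimpleGraph V} {a b : V}
    {P : G.Walk a b} (hP : P.IsPath) : IsVertexPath G P.length P.getVert where
  inj _ _ hi hj h := hP.getVert_injOn hi hj h
  adj _ hi := P.adj_getVert_succ hi

theorem IsVertexPath.mono {V : Type u} {G : SimpleGraph V} {m n : ℕ} {p : ℕ → V}
    (h : IsVertexPath G m p) (hn : n ≤ m) : IsVertexPath G n p where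
  inj i j hi hj := h.inj i j (hi.trans hn) (hj.trans hn)
  adj i hi := h.adj i (hi.trans_le hn)

/-- A vertex path from `y` to the set `T` that avoids `x` and meets `T` only at its end. -/
theorem exists_vertexPath_to_set {V : Type u} {G : SimpleGraph V} {x y t : V} {T : Set V}
    (hG : (G.induce {x}ᶜ).Preconnected) (hy : y ≠ x) (ht : t ∈ T) (htx : t ≠ x) :
    ∃ (m : ℕ) (p : ℕ → V), IsVertexPath G m p ∧ p 0 = y ∧ p m ∈ T ∧ (∀ i < m, p i ∉ T) ∧
      ∀ i, p i ≠ x := by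
  classical
  obtain ⟨W⟩ := hG ⟨y, hy⟩ ⟨t, htx⟩
  obtain ⟨P, hP⟩ : ∃ P : (G.induce {x}ᶜ).Walk ⟨y, hy⟩ ⟨t, htx⟩, P.IsPath :=
    ⟨W.toPath.1, W.toPath.2⟩
  have hex : ∃ m, (P.getVert m).1 ∈ T := ⟨P.length, by simpa using ht⟩
  have hle : Nat.find hex ≤ P.length := Nat.find_min' hex (by simpa using ht)
  have hV := hP.isVertexPath
  refine ⟨Nat.find hex, fun i => (P.getVert i).1, ⟨?_, ?_⟩, by simp, Nat.find_spec hex,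
    fun i hi => Nat.find_min hex hi, fun i => (P.getVert i).2⟩
  · intro i j hi hj hij
    exact hV.inj i j (hi.trans hle) (hj.trans hle) (Subtype.ext hij)
  · intro i hi
    exact hV.adj i (hi.trans_le hle)

namespace SlidingSystem

variable {V : Type u} {C : Type w} [DecidableEq V] {G : SimpleGraph V} {S : Set (V → Option C)}

/-- Sliding the vacancy along a path moves every occupied vertex of the path by one step. -/
theorem exists_slide_path (h : SlidingSystem G S) {Φ : V → Option C} (hΦ : Φ ∈ S) {p : ℕ → V}
    {m : ℕ} (hp : IsVertexPath G m p) (h0 : Φ (p 0) = none) :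
    ∃ Ψ ∈ S, Ψ (p m) = none ∧ (∀ i < m, Ψ (p i) = Φ (p (i + 1))) ∧
      ∀ x, (∀ i ≤ m, x ≠ p i) → Ψ x = Φ x := by
  induction m with
  | zero => exact ⟨Φ, hΦ, h0, by simp, by simp⟩
  | succ m ih =>
    obtain ⟨Ψ, hΨ, hm, hlt, hout⟩ := ih (hp.mono m.le_succ)
    have hnext : Ψ (p (m + 1)) = Φ (p (m + 1)) := by
      refine hout _ fun i hi he => ?_
      have := hp.inj _ _ le_rfl (by omega) he
      omega
    refine ⟨_, h.slide Ψ hΨ _ _ hm (hp.adj m m.lt_succ_self), by simpa using hm, ?_, ?_⟩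
    · intro i hi
      rcases Nat.lt_succ_iff_lt_or_eq.mp hi with hi' | rfl
      · rw [comp_apply, Equiv.swap_apply_of_ne_of_ne, hlt i hi']
        · intro he
          have := hp.inj _ _ (by omega) (by omega) he
          omega
        · intro he
          have := hp.inj _ _ (by omega) (by omega) he
          omega
      · simpa using hnext
    · intro x hx
      rw [comp_apply, Equiv.swap_apply_of_ne_of_ne (hx m (by omega)) (hx _ le_rfl)]
      exact hout x fun i hi => hx i (by omega)

theorem exists_slide_to (h : SlidingSystem G S) (hG : G.Preconnected) {Φ : V → Option C}
    (hΦ : Φ ∈ S) {x : V} (hx : Φ x = none) (y : V) : ∃ Ψ ∈ S, Ψ y = none := by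
  obtain ⟨W⟩ := hG x y
  obtain ⟨Ψ, hΨ, hm, -⟩ := h.exists_slide_path hΦ W.toPath.2.isVertexPath (by simpa using hx)
  exact ⟨Ψ, hΨ, by simpa using hm⟩

/-- The vacancy leaves `x` through `y` and slides to a first vertex of `T` on a route that avoids
`x` and does not depend on the configuration. -/
theorem exists_detour (h : SlidingSystem G S) {x y t : V} {T : Set V}
    (hG : (G.induce {x}ᶜ).Preconnected) (hxy : G.Adj x y) (ht : t ∈ T) (htx : t ≠ x) :
    ∃ t' ∈ T, t' ≠ x ∧ ∀ Φ ∈ S, Φ x = none → ∃ Ψ ∈ S, Ψ t' = none ∧ Ψ x = Φ y ∧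
      ∀ z ∈ T, z ≠ x → z ≠ t' → Ψ z = Φ z := by
  obtain ⟨m, p, hp, h0, hm, hT, hpx⟩ := exists_vertexPath_to_set hG hxy.ne' ht htx
  refine ⟨p m, hm, hpx m, fun Φ hΦ hΦx => ?_⟩
  obtain ⟨p', hp'0, hp's⟩ : ∃ p' : ℕ → V, p' 0 = x ∧ ∀ i, p' (i + 1) = p i :=
    ⟨fun i => Nat.casesOn i x p, rfl, fun _ => rfl⟩
  have hpath : IsVertexPath G (m + 1) p' := by
    constructor
    · rintro (_ | i) (_ | j) hi hj hij
      · rfl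
      · rw [hp'0, hp's] at hij
        exact absurd hij.symm (hpx j)
      · rw [hp'0, hp's] at hij
        exact absurd hij (hpx i)
      · rw [hp's, hp's] at hij
        rw [hp.inj i j (by omega) (by omega) hij]
    · rintro (_ | i) hi
      · rw [hp'0, hp's, h0]
        exact hxy
      · rw [hp's, hp's]
        exact hp.adj i (by omega)
  obtain ⟨Ψ, hΨ, hend, hlt, hout⟩ := h.exists_slide_path hΦ hpath (by rwa [hp'0])
  refine ⟨Ψ, hΨ, by rwa [hp's] at hend, ?_, ?_⟩
  · have := hlt 0 (by omega)
    rwa [hp'0, hp's, h0] at this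
  · intro z hz hzx hzt
    refine hout z ?_
    rintro (_ | i) hi
    · rwa [hp'0]
    · rw [hp's]
      rintro rfl
      rcases Nat.lt_or_ge i m with hi' | hi'
      · exact hT i hi' hz
      · obtain rfl : i = m := by omega
        exact hzt rfl

/-- If each vacant vertex only sees the value `c`, then all configurations are constantly `c`. -/
theorem eq_of_forall_adj (h : SlidingSystem G S) (hG : G.Preconnected) {c : C}
    (hc : ∀ Φ ∈ S, ∀ x y, Φ x = none → G.Adj x y → Φ y = some c) {Φ : V → Option C} (hΦ : Φ ∈ S)
    {x y : V} (hx : Φ x = none) (hyx : y ≠ x) : Φ y = some c := by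
  obtain ⟨W⟩ := hG x y
  have hp := W.toPath.2.isVertexPath
  set P := W.toPath.1
  have hlen : 0 < P.length := by
    rcases Nat.eq_zero_or_pos P.length with h0 | h0
    · exact absurd (SimpleGraph.Walk.eq_of_length_eq_zero h0).symm hyx
    · exact h0
  -- Stopping one step before `y` leaves the value of `y` untouched and makes `y` a neighbor of the
  -- vacancy.
  obtain ⟨Ψ, hΨ, hend, -, hout⟩ :=
    h.exists_slide_path hΦ (hp.mono (Nat.sub_le P.length 1)) (by simpa using hx)
  have hy : P.getVert P.length = y := P.getVert_length
  have hadj : G.Adj (P.getVert (P.length - 1)) y := by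
    have := hp.adj (P.length - 1) (by omega)
    rwa [Nat.sub_add_cancel hlen, hy] at this
  rw [← hc Ψ hΨ _ y hend hadj]
  refine (hout y fun i hi he => ?_).symm
  have := hp.inj _ _ le_rfl (by omega) (hy.trans he)
  omega

/-- If one vertex sees only the value `c` whenever it is vacant, then so does every vertex. -/
theorem forall_adj_of_exists (h : SlidingSystem G S) (hG : G.Preconnected)
    (hG' : ∀ x, (G.induce {x}ᶜ).Preconnected) {c : C} {x : V}
    (hx : ∀ Φ ∈ S, Φ x = none → ∀ y, G.Adj x y → Φ y = some c) :
    ∀ z, ∀ Φ ∈ S, Φ z = none → ∀ y, G.Adj z y → Φ y = some c := by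
  have step : ∀ x z, G.Adj x z → (∀ Φ ∈ S, Φ x = none → ∀ y, G.Adj x y → Φ y = some c) →
      ∀ Φ ∈ S, Φ z = none → ∀ y, G.Adj z y → Φ y = some c := by
    intro x z hxz hx Φ hΦ hz y hzy
    -- The vacancy leaves `z` through `y` and reaches `x` without returning to `z`. The old value of
    -- `y` now sits on `z`, a neighbor of the vacant `x`, so it is `c`.
    obtain ⟨t, rfl, -, hd⟩ := h.exists_detour (T := {x}) (hG' z) hzy rfl hxz.ne
    obtain ⟨Ψ, hΨ, hΨt, hΨz, -⟩ := hd Φ hΦ hz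
    rw [← hΨz]
    exact hx Ψ hΨ hΨt z hxz
  intro z
  obtain ⟨W⟩ := hG x z
  induction W with
  | nil => exact hx
  | cons hadj _ ih => exact ih (step _ _ hadj hx)

/-- A triangle at the vacant vertex allows to exchange the values of its two other vertices. -/
theorem comp_swap_mem (h : SlidingSystem G S) {Φ : V → Option C} (hΦ : Φ ∈ S) {x y z : V}
    (hx : Φ x = none) (hxy : G.Adj x y) (hxz : G.Adj x z) (hyz : G.Adj y z) :
    Φ ∘ Equiv.swap y z ∈ S := by
  -- The vacancy travels round the triangle `x → y → z → x`; the three transpositions compose to the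
  -- exchange of `y` and `z`.
  have h1 := h.slide Φ hΦ x y hx hxy
  have h2 := h.slide _ h1 y z (by simpa using hx) hyz
  have h3 := h.slide _ h2 z x (by simpa using hx) hxz.symm
  convert h3 using 1
  rw [comp_assoc, comp_assoc, ← Equiv.coe_trans, ← Equiv.coe_trans]
  congr 2
  ext a
  simp only [Equiv.trans_apply, Equiv.swap_apply_def]
  have := hxy.ne
  have := hxz.ne
  have := hyz.ne
  split_ifs <;> simp_all

end SlidingSystem

/-! ### Induced cycles and rotation around them -/

/-- An induced cycle of length `n + 3`, given by an `(n + 3)`-periodic sequence of vertices. -/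
structure IsInducedCycle {V : Type u} (G : SimpleGraph V) (n : ℕ) (q : ℕ → V) : Prop where
  periodic : ∀ i, q (i + (n + 3)) = q i
  inj : ∀ i j, j < n + 3 → q (i + j) = q i → j = 0
  adj : ∀ i j, j < n + 3 → (G.Adj (q i) (q (i + j)) ↔ j = 1 ∨ j = n + 2)

namespace IsInducedCycle

variable {V : Type u} {G : SimpleGraph V} {n : ℕ} {q : ℕ → V}

theorem shift (h : IsInducedCycle G n q) (a : ℕ) : IsInducedCycle G n fun i => q (a + i) where
  periodic i := by rw [← add_assoc, h.periodic]
  inj i j hj he := h.inj (a + i) j hj (by rwa [add_assoc])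
  adj i j hj := by rw [← h.adj (a + i) j hj, add_assoc]

theorem eq_of_eq (h : IsInducedCycle G n q) {i j : ℕ} (hi : i < n + 3) (hj : j < n + 3)
    (he : q i = q j) : i = j := by
  rcases le_total i j with hij | hij
  · have := h.inj i (j - i) (by omega) (by rw [Nat.add_sub_cancel' hij, he])
    omega
  · have := h.inj j (i - j) (by omega) (by rw [Nat.add_sub_cancel' hij, he])
    omega

theorem apply_mod (h : IsInducedCycle G n q) (i : ℕ) : q (i % (n + 3)) = q i :=
  Function.Periodic.map_mod_nat h.periodic i

theorem exists_lt (h : IsInducedCycle G n q) {x : V} (hx : x ∈ Set.range q) :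
    ∃ i < n + 3, q i = x := by
  obtain ⟨i, rfl⟩ := hx
  exact ⟨i % (n + 3), Nat.mod_lt _ (by omega), h.apply_mod i⟩

theorem isVertexPath (h : IsInducedCycle G n q) : IsVertexPath G (n + 2) q where
  inj _ _ hi hj he := h.eq_of_eq (by omega) (by omega) he
  adj i _ := (h.adj i 1 (by omega)).2 (Or.inl rfl)

theorem adj_zero_iff (h : IsInducedCycle G n q) {i : ℕ} (hi : i < n + 3) :
    G.Adj (q 0) (q i) ↔ i = 1 ∨ i = n + 2 := by
  simpa using h.adj 0 i hi

/-- The graph is a cycle if it has a spanning induced cycle. -/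
theorem nonempty_iso (h : IsInducedCycle G n q) (hq : ∀ x, x ∈ Set.range q) :
    Nonempty (SimpleGraph.cycleGraph (n + 3) ≃g G) := by
  refine ⟨⟨Equiv.ofBijective (fun i : Fin (n + 3) => q i) ⟨?_, ?_⟩, ?_⟩⟩
  · intro i j hij
    exact Fin.ext (h.eq_of_eq i.2 j.2 hij)
  · intro x
    obtain ⟨i, hi, rfl⟩ := h.exists_lt (hq x)
    exact ⟨⟨i, hi⟩, rfl⟩
  · intro i j
    have key : ∀ a b : Fin (n + 3), a ≤ b → (G.Adj (q a) (q b) ↔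
        (SimpleGraph.cycleGraph (n + 3)).Adj a b) := by
      intro a b hab
      have hab' : a.1 ≤ b.1 := hab
      have := h.adj a (b - a) (by omega)
      rw [Nat.add_sub_cancel' hab'] at this
      rw [this, SimpleGraph.cycleGraph_adj']
      rw [Fin.coe_sub_iff_le.2 hab]
      rcases hab.eq_or_lt with rfl | hlt
      · simp
      · rw [Fin.coe_sub_iff_lt.2 hlt]
        have : a.1 < b.1 := hlt
        omega
    rcases le_total i j with hij | hij
    · exact key i j hij
    · have := key j i hij
      exact (G.adj_comm _ _).trans (this.trans (SimpleGraph.adj_comm _ _ _))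

end IsInducedCycle

namespace SlidingSystem

variable {V : Type u} {C : Type w} [DecidableEq V] {G : SimpleGraph V} {S : Set (V → Option C)}
  {n : ℕ} {q : ℕ → V}

/-- The vacancy slides once around an induced cycle. -/
theorem exists_rotate (h : SlidingSystem G S) (hq : IsInducedCycle G n q) {Φ : V → Option C}
    (hΦ : Φ ∈ S) (h0 : Φ (q 0) = none) :
    ∃ Ψ ∈ S, Ψ (q 0) = none ∧ Ψ (q (n + 2)) = Φ (q 1) ∧
      (∀ i, 1 ≤ i → i < n + 2 → Ψ (q i) = Φ (q (i + 1))) ∧ ∀ x ∉ Set.range q, Ψ x = Φ x := by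
  obtain ⟨Ψ, hΨ, hend, hlt, hout⟩ := h.exists_slide_path hΦ hq.isVertexPath h0
  have hadj : G.Adj (q (n + 2)) (q 0) := ((hq.adj_zero_iff (by omega)).2 (Or.inr rfl)).symm
  refine ⟨_, h.slide Ψ hΨ _ _ hend hadj, by simpa using hend, ?_, ?_, ?_⟩
  · simpa using hlt 0 (by omega)
  · intro i hi hi'
    rw [comp_apply, Equiv.swap_apply_of_ne_of_ne, hlt i hi']
    · intro he
      have := hq.eq_of_eq (by omega) (by omega) he
      omega
    · intro he
      have := hq.eq_of_eq (by omega) (by omega) he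
      omega
  · intro x hx
    rw [comp_apply, Equiv.swap_apply_of_ne_of_ne]
    · exact hout x fun i _ he => hx ⟨i, he.symm⟩
    · exact fun he => hx ⟨_, he.symm⟩
    · exact fun he => hx ⟨_, he.symm⟩

end SlidingSystem

/-! ### Balanced systems and long induced cycles -/

/-- A sliding system on a weighted graph without cut vertices in which the weights at a vacant vertex
of the neighbors of a given value do not depend on the configuration, and a vacant vertex always sees
two values. -/
structure BalancedSystem {V : Type u} {C : Type w} [Fintype V] [DecidableEq V] [DecidableEq C]
    (G : SimpleGraph V) (μ : V → V → ℕ) (S : Set (V → Option C)) : Prop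
    extends SlidingSystem G S where
  preconnected : G.Preconnected
  preconnected_compl : ∀ x, (G.induce {x}ᶜ).Preconnected
  nonempty : ∃ Φ ∈ S, ∃ x, Φ x = none
  symm : ∀ x y, μ x y = μ y x
  pos_iff : ∀ x y, 0 < μ x y ↔ G.Adj x y
  balanced : ∀ Φ ∈ S, ∀ Ψ ∈ S, ∀ x, Φ x = none → Ψ x = none → ∀ o : Option C,
    ∑ y, (if Φ y = o then μ x y else 0) = ∑ y, (if Ψ y = o then μ x y else 0)
  colorful : ∀ Φ ∈ S, ∀ x, Φ x = none → ∃ y z, G.Adj x y ∧ G.Adj x z ∧ Φ y ≠ Φ z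

theorem Finset.add_eq_add_of_sum_eq {V : Type u} [Fintype V] [DecidableEq V] {f g : V → ℕ} {a b : V}
    (hab : a ≠ b) (hsum : ∑ y, f y = ∑ y, g y) (hfg : ∀ y, y ≠ a → y ≠ b → f y = g y) :
    f a + f b = g a + g b := by
  have hb : b ∈ Finset.univ.erase a := by simp [hab.symm]
  rw [← Finset.add_sum_erase _ _ (Finset.mem_univ a), ← Finset.add_sum_erase _ _ hb,
    ← Finset.add_sum_erase _ g (Finset.mem_univ a), ← Finset.add_sum_erase _ g hb] at hsum
  have : ∑ y ∈ (Finset.univ.erase a).erase b, f y = ∑ y ∈ (Finset.univ.erase a).erase b, g y := by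
    refine Finset.sum_congr rfl fun y hy => ?_
    simp only [Finset.mem_erase] at hy
    exact hfg y hy.2.1 hy.1
  omega

namespace BalancedSystem

variable {V : Type u} {C : Type w} [Fintype V] [DecidableEq V] [DecidableEq C]
  {G : SimpleGraph V} {μ : V → V → ℕ} {S : Set (V → Option C)} {n : ℕ} {q : ℕ → V}

/-- Non-neighbors of `x` have weight zero, so all terms other than those of `a` and `b` cancel from
the balanced sums. -/
theorem pair_balanced (h : BalancedSystem G μ S) {Φ Ψ : V → Option C} (hΦ : Φ ∈ S) (hΨ : Ψ ∈ S)
    {x a b : V} (hΦx : Φ x = none) (hΨx : Ψ x = none) (hab : a ≠ b)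
    (hout : ∀ y, y ≠ a → y ≠ b → G.Adj x y → Φ y = Ψ y) (o : Option C) :
    (if Φ a = o then μ x a else 0) + (if Φ b = o then μ x b else 0) =
      (if Ψ a = o then μ x a else 0) + (if Ψ b = o then μ x b else 0) := by
  refine Finset.add_eq_add_of_sum_eq (f := fun y => if Φ y = o then μ x y else 0)
    (g := fun y => if Ψ y = o then μ x y else 0) hab (h.balanced Φ hΦ Ψ hΨ x hΦx hΨx o) ?_
  intro y hya hyb
  by_cases hy : G.Adj x y
  · simp only [hout y hya hyb hy]
  · have : μ x y = 0 := by
      by_contra hne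
      exact hy ((h.pos_iff x y).1 (Nat.pos_of_ne_zero hne))
    simp [this]

theorem weight_eq_of_exchange (h : BalancedSystem G μ S) {Φ Ψ : V → Option C} (hΦ : Φ ∈ S)
    (hΨ : Ψ ∈ S) {x a b : V} (hΦx : Φ x = none) (hΨx : Ψ x = none) (hab : Φ a ≠ Φ b)
    (ha : Ψ a = Φ b) (hb : Ψ b = Φ a)
    (hout : ∀ y, y ≠ a → y ≠ b → G.Adj x y → Φ y = Ψ y) : μ x a = μ x b := by
  have := h.pair_balanced hΦ hΨ hΦx hΨx (ne_of_apply_ne Φ hab) hout (Φ a)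
  simpa [ha, hb, hab, hab.symm] using this

/-- Compare `Φ` with its rotation: the neighbors of `q 0` on the cycle change their values from `Φ
(q 1)`, `Φ (q (n + 2))` to `Φ (q 2)`, `Φ (q 1)`, and nothing off the cycle changes. Balance for the
value `Φ (q (n + 2))` then forces both claims. -/
theorem induced_cycle (h : BalancedSystem G μ S) (hq : IsInducedCycle G n q) {Φ : V → Option C}
    (hΦ : Φ ∈ S) (h0 : Φ (q 0) = none) :
    Φ (q 2) = Φ (q (n + 2)) ∧
      (Φ (q 1) ≠ Φ (q (n + 2)) → μ (q 0) (q 1) = μ (q 0) (q (n + 2))) := by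
  obtain ⟨Ψ, hΨ, hΨ0, hlast, hlt, hout⟩ := h.exists_rotate hq hΦ h0
  have hne : q 1 ≠ q (n + 2) := fun he => by
    have := hq.eq_of_eq (by omega) (by omega) he
    omega
  have h1 : Ψ (q 1) = Φ (q 2) := hlt 1 le_rfl (by omega)
  have hpos1 : 0 < μ (q 0) (q 1) :=
    (h.pos_iff _ _).2 ((hq.adj_zero_iff (by omega)).2 (Or.inl rfl))
  have hpos2 : 0 < μ (q 0) (q (n + 2)) :=
    (h.pos_iff _ _).2 ((hq.adj_zero_iff (by omega)).2 (Or.inr rfl))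
  have key := h.pair_balanced hΦ hΨ h0 hΨ0 hne ?_
  · rw [h1, hlast] at key
    by_cases he : Φ (q 1) = Φ (q (n + 2))
    · refine ⟨?_, fun hn => absurd he hn⟩
      have := key (Φ (q (n + 2)))
      by_contra hne2
      simp only [he, hne2, if_true, if_false] at this
      omega
    · have := key (Φ (q (n + 2)))
      simp only [he, if_true, if_false] at this
      have h2 : Φ (q 2) = Φ (q (n + 2)) := by
        by_contra hne2
        simp only [hne2, if_false] at this
        omega
      refine ⟨h2, fun _ => ?_⟩
      simp only [h2, if_true] at this
      omega
  · intro y hy1 hy2 hadj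
    refine (hout y fun hy => ?_).symm
    obtain ⟨i, hi, rfl⟩ := hq.exists_lt hy
    rcases (hq.adj_zero_iff hi).1 hadj with rfl | rfl
    · exact hy1 rfl
    · exact hy2 rfl

/-- The case `i = 1` is `induced_cycle` for the rotated configuration; each further rotation raises
the index by one. So the values along the occupied part of the cycle have period two. -/
theorem apply_add_two (h : BalancedSystem G μ S) (hq : IsInducedCycle G n q) (i : ℕ) :
    ∀ Φ ∈ S, Φ (q 0) = none → 1 ≤ i → i ≤ n → Φ (q (i + 2)) = Φ (q i) := by
  induction i with
  | zero => intro Φ _ _ h1; omega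
  | succ i ih =>
    intro Φ hΦ h0 _ hi
    obtain ⟨Ψ, hΨ, hΨ0, hlast, hlt, -⟩ := h.exists_rotate hq hΦ h0
    rcases Nat.eq_zero_or_pos i with rfl | hpos
    · have h2 := (h.induced_cycle hq hΨ hΨ0).1
      rw [hlast, hlt 2 (by omega) (by omega)] at h2
      exact h2
    · have := ih Ψ hΨ hΨ0 hpos (by omega)
      rwa [hlt i hpos (by omega), hlt (i + 2) (by omega) (by omega)] at this

theorem apply_ne_succ (h : BalancedSystem G μ S) (hq : IsInducedCycle G n q) {Φ : V → Option C}
    (hΦ : Φ ∈ S) (h0 : Φ (q 0) = none) (hne : Φ (q 1) ≠ Φ (q (n + 2))) {i : ℕ} (hi : 1 ≤ i)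
    (hi' : i ≤ n + 1) : Φ (q i) ≠ Φ (q (i + 1)) := by
  induction i, hi using Nat.le_induction with
  | base => rwa [(h.induced_cycle hq hΦ h0).1]
  | succ i hi ih =>
    rw [show i + 1 + 1 = i + 2 from rfl, h.apply_add_two hq i Φ hΦ h0 hi (by omega)]
    exact (ih (by omega)).symm

theorem apply_eq_of_eq (h : BalancedSystem G μ S) (hq : IsInducedCycle G n q) {Φ : V → Option C}
    (hΦ : Φ ∈ S) (h0 : Φ (q 0) = none) (he : Φ (q 1) = Φ (q (n + 2))) {i : ℕ} (hi : 1 ≤ i)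
    (hi' : i ≤ n + 2) : Φ (q i) = Φ (q 1) := by
  induction i using Nat.strong_induction_on with
  | _ i ih =>
    match i, hi with
    | 1, _ => rfl
    | 2, _ => rw [he, (h.induced_cycle hq hΦ h0).1]
    | i + 3, _ =>
      rw [show i + 3 = i + 1 + 2 from rfl, h.apply_add_two hq (i + 1) Φ hΦ h0 (by omega) (by omega)]
      exact ih (i + 1) (by omega) (by omega) (by omega)

/-- An induced cycle whose vacant vertex sees two values on it is odd. -/
theorem even_of_ne (h : BalancedSystem G μ S) (hq : IsInducedCycle G n q) {Φ : V → Option C}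
    (hΦ : Φ ∈ S) (h0 : Φ (q 0) = none) (hne : Φ (q 1) ≠ Φ (q (n + 2))) : Even n := by
  -- By period two, all odd positions carry the value of `q 1`; for odd `n` the last position `n +
  -- 2` would be among them.
  have key : ∀ i, 2 * i + 1 ≤ n + 2 → Φ (q (2 * i + 1)) = Φ (q 1) := by
    intro i
    induction i with
    | zero => intro _; rfl
    | succ i ih =>
      intro hi
      rw [show 2 * (i + 1) + 1 = 2 * i + 1 + 2 by ring,
        h.apply_add_two hq (2 * i + 1) Φ hΦ h0 (by omega) (by omega)]
      exact ih (by omega)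
  by_contra hn
  obtain ⟨i, hi⟩ := Nat.not_even_iff_odd.1 hn
  refine hne (Eq.symm ?_)
  have := key (i + 1) (by omega)
  rwa [show 2 * (i + 1) + 1 = n + 2 by omega] at this

/-- After one slide along the cycle, the new vacancy sees the moved value behind it and, by
`induced_cycle`, the value of the other old neighbor ahead of it. So it sees the same two values. -/
theorem exists_ne_shift (h : BalancedSystem G μ S) (hq : IsInducedCycle G n q) {Φ : V → Option C}
    (hΦ : Φ ∈ S) (h0 : Φ (q 0) = none) (hne : Φ (q 1) ≠ Φ (q (n + 2))) (j : ℕ) :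
    ∃ Ψ ∈ S, Ψ (q j) = none ∧ Ψ (q (j + 1)) ≠ Ψ (q (j + (n + 2))) := by
  induction j with
  | zero => exact ⟨Φ, hΦ, h0, by simpa using hne⟩
  | succ j ih =>
    obtain ⟨Ψ, hΨ, hj, hΨne⟩ := ih
    have hqj := hq.shift j
    have h2 := (h.induced_cycle hqj hΨ hj).1
    refine ⟨_, h.slide Ψ hΨ _ _ hj (hqj.isVertexPath.adj 0 (by omega)), by simpa using hj, ?_⟩
    have e1 : q (j + 1 + 1) ≠ q j := fun he => by
      have := hq.inj j 2 (by omega) he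
      omega
    have e2 : q (j + 1 + 1) ≠ q (j + 1) := fun he => by
      have := hq.inj (j + 1) 1 (by omega) he
      omega
    rw [show j + 1 + (n + 2) = j + (n + 3) by ring, hq.periodic, comp_apply, comp_apply,
      Equiv.swap_apply_of_ne_of_ne e1 e2]
    simp only [zero_add, Equiv.swap_apply_left]
    rw [show j + 1 + 1 = j + 2 from rfl, h2]
    exact hΨne.symm

/-- The route of a detour from an induced cycle of length at least five determines the value of its
first vertex. -/
theorem exists_index_of_detour (h : BalancedSystem G μ S) (hq : IsInducedCycle G n q) (hn : 2 ≤ n)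
    {y : V} (hadj : G.Adj (q 0) y) :
    ∃ i, 1 ≤ i ∧ i ≤ n + 1 ∧ ∀ Φ ∈ S, Φ (q 0) = none → Φ (q 1) ≠ Φ (q (n + 2)) →
      Φ y = Φ (q i) := by
  have hq10 : q 1 ≠ q 0 := fun he => by
    have := hq.eq_of_eq (by omega) (by omega) he
    omega
  obtain ⟨t, ht, ht0, hd⟩ := h.exists_detour (T := Set.range q) (h.preconnected_compl (q 0)) hadj
    ⟨1, rfl⟩ hq10
  obtain ⟨j, hj, rfl⟩ := hq.exists_lt ht
  have hj0 : j ≠ 0 := fun he => ht0 (by rw [he])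
  have hqj := hq.shift j
  have key : ∀ Φ ∈ S, Φ (q 0) = none → ∃ Ψ ∈ S, Ψ (q (j + 0)) = none ∧ Ψ (q (n + 3)) = Φ y ∧
      (∀ i, 1 ≤ i → i < n + 3 → i ≠ j → Ψ (q i) = Φ (q i)) ∧
      ∀ i, 1 ≤ i → i < n + 3 → i ≠ j → Ψ (q (i + (n + 3))) = Φ (q i) := by
    intro Φ hΦ hΦ0
    obtain ⟨Ψ, hΨ, hΨj, hΨ0, hout⟩ := hd Φ hΦ hΦ0
    have hout' : ∀ i, 1 ≤ i → i < n + 3 → i ≠ j → Ψ (q i) = Φ (q i) := by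
      intro i hi hi' hij
      refine hout _ ⟨i, rfl⟩ (fun he => ?_) fun he => hij (hq.eq_of_eq hi' hj he)
      have := hq.eq_of_eq hi' (by omega) he
      omega
    refine ⟨Ψ, hΨ, hΨj, ?_, hout', fun i hi hi' hij => ?_⟩
    · have := hq.periodic 0
      rw [zero_add] at this
      rw [this, hΨ0]
    · rw [hq.periodic, hout' i hi hi' hij]
  -- After the detour `q 0` carries `Φ y` and `q j` is vacant. If `j` is next to `0`, period two
  -- along the cycle read from `q j` equates `q 0` with a vertex two steps away, which has kept its
  -- value.
  rcases (by omega : j = 1 ∨ j = n + 2 ∨ (2 ≤ j ∧ j ≤ n + 1)) with rfl | rfl | ⟨hj2, hjn⟩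
  · refine ⟨n + 1, by omega, le_rfl, fun Φ hΦ hΦ0 hne => ?_⟩
    obtain ⟨Ψ, hΨ, hΨj, hΨ0, hout, -⟩ := key Φ hΦ hΦ0
    have := h.apply_add_two hqj n Ψ hΨ hΨj (by omega) le_rfl
    rw [show 1 + (n + 2) = n + 3 by ring, hΨ0, show 1 + n = n + 1 by ring,
      hout (n + 1) (by omega) (by omega) (by omega)] at this
    exact this
  · refine ⟨2, by omega, by omega, fun Φ hΦ hΦ0 hne => ?_⟩
    obtain ⟨Ψ, hΨ, hΨj, hΨ0, -, hout⟩ := key Φ hΦ hΦ0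
    have := h.apply_add_two hqj 1 Ψ hΨ hΨj le_rfl (by omega)
    rw [show n + 2 + 1 = n + 3 by ring, hΨ0, show n + 2 + (1 + 2) = 2 + (n + 3) by ring,
      hout 2 (by omega) (by omega) (by omega)] at this
    exact this.symm
  · refine ⟨1, by omega, by omega, fun Φ hΦ hΦ0 hne => ?_⟩
    -- A return to the middle is impossible: both cycle neighbors of `q j` have equal values by
    -- period two, so the whole cycle is constant, although two consecutive vertices have kept
    -- distinct values. The pair lies before `q j` if `j = n + 1` and after it otherwise.
    exfalso
    obtain ⟨Ψ, hΨ, hΨj, hΨ0, hout, hout'⟩ := key Φ hΦ hΦ0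
    have e1 : Ψ (q (j + 1)) = Φ (q (j + 1)) := hout _ (by omega) (by omega) (by omega)
    have e2 : Ψ (q (j + (n + 2))) = Φ (q (j - 1)) := by
      rw [show j + (n + 2) = j - 1 + (n + 3) by omega]
      exact hout' _ (by omega) (by omega) (by omega)
    have e3 : Φ (q (j + 1)) = Φ (q (j - 1)) := by
      have := h.apply_add_two hq (j - 1) Φ hΦ hΦ0 (by omega) (by omega)
      rwa [show j - 1 + 2 = j + 1 by omega] at this
    have hconst := fun i => h.apply_eq_of_eq (i := i) hqj hΨ hΨj (by rw [e1, e2, e3])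
    rcases Nat.lt_or_ge n j with hlt | hle
    · obtain rfl : j = n + 1 := by omega
      have c1 := hconst (n + 1) (by omega) (by omega)
      rw [e1, show n + 1 + (n + 1) = n - 1 + (n + 3) by omega,
        hout' _ (by omega) (by omega) (by omega), e3] at c1
      refine h.apply_ne_succ hq hΦ hΦ0 hne (i := n - 1) (by omega) (by omega) ?_
      rw [c1]
      congr 2
      omega
    · have c1 := hconst 2 (by omega) (by omega)
      rw [e1, hout (j + 2) (by omega) (by omega) (by omega)] at c1
      exact h.apply_ne_succ hq hΦ hΦ0 hne (i := j + 1) (by omega) (by omega) c1.symm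

/-- An induced cycle of length at least five whose vacant vertex sees two values on it is spanning. -/
theorem mem_range_of_ne (h : BalancedSystem G μ S) (hq : IsInducedCycle G n q) (hn : 2 ≤ n)
    {Φ : V → Option C} (hΦ : Φ ∈ S) (h0 : Φ (q 0) = none) (hne : Φ (q 1) ≠ Φ (q (n + 2)))
    (x : V) : x ∈ Set.range q := by
  have adj_mem : ∀ q : ℕ → V, IsInducedCycle G n q → (∃ Φ ∈ S, Φ (q 0) = none ∧
      Φ (q 1) ≠ Φ (q (n + 2))) → ∀ y, G.Adj (q 0) y → y ∈ Set.range q := by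
    rintro q hq ⟨Φ, hΦ, h0, hne⟩ y hadj
    by_contra hy
    -- A rotation keeps the value of `y`, which is off the cycle, but replaces that of `q i` by the
    -- different value of `q (i + 1)`; yet the same index `i` serves both configurations.
    obtain ⟨i, hi, hi', hval⟩ := h.exists_index_of_detour hq hn hadj
    obtain ⟨Ψ, hΨ, hΨ0, hlast, hlt, hout⟩ := h.exists_rotate hq hΦ h0
    have h1 := hval Φ hΦ h0 hne
    have h2 := hval Ψ hΨ hΨ0 (by
      rw [hlast, hlt 1 le_rfl (by omega)]
      exact (h.apply_ne_succ hq hΦ h0 hne le_rfl (by omega)).symm)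
    rw [hout y hy, hlt i hi (by omega)] at h2
    exact h.apply_ne_succ hq hΦ h0 hne hi hi' (h1.symm.trans h2)
  by_contra hx
  obtain ⟨W⟩ := h.preconnected (q 0) x
  obtain ⟨d, -, ⟨j, hj⟩, hd⟩ := W.exists_boundary_dart (Set.range q) ⟨0, rfl⟩ hx
  obtain ⟨i, hi⟩ := adj_mem _ (hq.shift j) (h.exists_ne_shift hq hΦ h0 hne j) d.snd
    (by simp [hj])
  exact hd ⟨j + i, hi⟩

end BalancedSystem

/-! ### Finding induced cycles through a given vertex -/

theorem IsInducedCycle.of_injOn {V : Type u} {G : SimpleGraph V} {n : ℕ} {f : ℕ → V}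
    (hinj : ∀ i j, i < j → j < n + 3 → f i ≠ f j)
    (hadj : ∀ i j, i < j → j < n + 3 → (G.Adj (f i) (f j) ↔ j = i + 1 ∨ i = 0 ∧ j = n + 2)) :
    IsInducedCycle G n fun i => f (i % (n + 3)) := by
  have hmod : ∀ i j, j < n + 3 → (i % (n + 3) + j < n + 3 ∧ (i + j) % (n + 3) = i % (n + 3) + j) ∨
      (n + 3 ≤ i % (n + 3) + j ∧ (i + j) % (n + 3) + (n + 3) = i % (n + 3) + j) := by
    intro i j hj
    have hi : i % (n + 3) < n + 3 := Nat.mod_lt _ (by omega)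
    rw [Nat.add_mod, Nat.mod_eq_of_lt hj]
    rcases Nat.lt_or_ge (i % (n + 3) + j) (n + 3) with hlt | hge
    · exact Or.inl ⟨hlt, Nat.mod_eq_of_lt hlt⟩
    · refine Or.inr ⟨hge, ?_⟩
      rw [Nat.mod_eq_sub_mod hge, Nat.mod_eq_of_lt (by omega)]
      omega
  constructor
  · intro i
    simp
  · intro i j hj he
    have hi : i % (n + 3) < n + 3 := Nat.mod_lt _ (by omega)
    by_contra hj0
    rcases hmod i j hj with ⟨h1, h2⟩ | ⟨h1, h2⟩
    · exact hinj _ _ (by omega) (by omega) he.symm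
    · exact hinj _ _ (by omega) (by omega) he
  · intro i j hj
    have hi : i % (n + 3) < n + 3 := Nat.mod_lt _ (by omega)
    rcases Nat.eq_zero_or_pos j with rfl | hj0
    · simp
    · rcases hmod i j hj with ⟨h1, h2⟩ | ⟨h1, h2⟩
      · rw [hadj _ _ (by omega) (by omega)]
        omega
      · rw [G.adj_comm, hadj _ _ (by omega) (by omega)]
        omega

/-- Two neighbors of `x` that are related by a negatively transitive relation can be chosen such that
`x` and a shortest path between them that avoids `x` form an induced cycle. -/
theorem exists_isInducedCycle_of_rel {V : Type u} {G : SimpleGraph V} {x a b : V}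
    (hG : (G.induce {x}ᶜ).Preconnected) {R : V → V → Prop} (hirr : ∀ a, ¬ R a a)
    (htrans : ∀ a b y, R a b → R a y ∨ R y b) (hxa : G.Adj x a) (hxb : G.Adj x b) (hab : R a b) :
    ∃ (n : ℕ) (q : ℕ → V), IsInducedCycle G n q ∧ q 0 = x ∧ R (q 1) (q (n + 2)) := by
  classical
  have hex : ∃ m : ℕ, ∃ (a b : ({x}ᶜ : Set V)) (P : (G.induce {x}ᶜ).Walk a b),
      G.Adj x a ∧ G.Adj x b ∧ R a b ∧ P.length = m := by
    obtain ⟨P⟩ := hG ⟨a, hxa.ne'⟩ ⟨b, hxb.ne'⟩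
    exact ⟨P.length, _, _, P, hxa, hxb, hab, rfl⟩
  -- The pair of related neighbors and the walk between them are minimized together; minimality
  -- rules out repeated vertices, chords and further neighbors of `x`.
  obtain ⟨m, ⟨⟨a, b, P, hxa, hxb, hab, hP⟩, hmin⟩⟩ :
      ∃ m : ℕ, (∃ (a b : ({x}ᶜ : Set V)) (P : (G.induce {x}ᶜ).Walk a b),
      G.Adj x a ∧ G.Adj x b ∧ R a b ∧ P.length = m) ∧
      ∀ (a b : ({x}ᶜ : Set V)) (P : (G.induce {x}ᶜ).Walk a b),
      G.Adj x a → G.Adj x b → R a b → m ≤ P.length :=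
    ⟨Nat.find hex, Nat.find_spec hex, fun a b P h1 h2 h3 =>
      Nat.find_min' hex ⟨a, b, P, h1, h2, h3, rfl⟩⟩
  obtain ⟨n, rfl⟩ : ∃ n, m = n + 1 := by
    refine Nat.exists_eq_succ_of_ne_zero fun h0 => ?_
    have := SimpleGraph.Walk.eq_of_length_eq_zero (hP.trans h0)
    subst this
    exact hirr _ hab
  -- By negative transitivity an inner neighbor of `x` would be related to one of the two ends,
  -- which gives a shorter walk.
  have hinner : ∀ i, 0 < i → i < n + 1 → ¬ G.Adj x (P.getVert i) := by
    intro i hi hi' hadj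
    rcases htrans _ _ (P.getVert i).1 hab with h1 | h1
    · have := hmin _ _ (P.take i) hxa hadj h1
      rw [P.take_length] at this
      omega
    · have := hmin _ _ (P.drop i) hadj hxb h1
      rw [P.drop_length] at this
      omega
  have hinj : ∀ i j, i < j → j < n + 2 → P.getVert i ≠ P.getVert j := by
    intro i j hij hj he
    have := hmin _ _ ((P.take i).append ((P.drop j).copy he.symm rfl)) hxa hxb hab
    rw [SimpleGraph.Walk.length_append, SimpleGraph.Walk.length_copy, P.take_length,
      P.drop_length] at this
    omega
  have hadj : ∀ i j, i < j → j < n + 2 →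
      (G.Adj (P.getVert i).1 (P.getVert j).1 ↔ j = i + 1) := by
    intro i j hij hj
    constructor
    · intro he
      have he' : (G.induce {x}ᶜ).Adj (P.getVert i) (P.getVert j) := he
      have := hmin _ _ ((P.take i).append (.cons he' (P.drop j))) hxa hxb hab
      rw [SimpleGraph.Walk.length_append, SimpleGraph.Walk.length_cons, P.take_length,
        P.drop_length] at this
      omega
    · rintro rfl
      exact P.adj_getVert_succ (by omega)
  obtain ⟨f, hf0, hfs⟩ : ∃ f : ℕ → V, f 0 = x ∧ ∀ i, f (i + 1) = (P.getVert i).1 :=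
    ⟨fun i => Nat.casesOn i x fun i => (P.getVert i).1, rfl, fun _ => rfl⟩
  refine ⟨n, _, IsInducedCycle.of_injOn (f := f) ?_ ?_, by simpa using hf0, ?_⟩
  · rintro (_ | i) (_ | j) hij hj
    · omega
    · rw [hf0, hfs]
      exact fun he => (P.getVert j).2 he.symm
    · omega
    · rw [hfs, hfs]
      exact fun he => hinj i j (by omega) (by omega) (Subtype.ext he)
  · rintro (_ | i) (_ | j) hij hj
    · omega
    · rw [hf0, hfs]
      constructor
      · intro h
        by_contra hne
        exact hinner j (by omega) (by omega) h
      · rintro (h | ⟨-, h⟩)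
        · obtain rfl : j = 0 := by omega
          simpa using hxa
        · obtain rfl : j = P.length := by omega
          simpa using hxb
    · omega
    · rw [hfs, hfs, hadj i j (by omega) (by omega)]
      omega
  · have hend : P.getVert (n + 1) = b := by
      rw [← hP]
      exact P.getVert_length
    show R (f (1 % (n + 3))) (f ((n + 2) % (n + 3)))
    rw [Nat.mod_eq_of_lt (by omega), Nat.mod_eq_of_lt (by omega), hfs, hfs, hend]
    simpa using hab

/-! ### Triangles and the classification of balanced systems -/

namespace BalancedSystem

variable {V : Type u} {C : Type w} [Fintype V] [DecidableEq V] [DecidableEq C]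
  {G : SimpleGraph V} {μ : V → V → ℕ} {S : Set (V → Option C)} {n : ℕ} {q : ℕ → V}

/-- Every vacant vertex is on an induced cycle on which it sees two values. -/
theorem exists_isInducedCycle (h : BalancedSystem G μ S) {Φ : V → Option C} (hΦ : Φ ∈ S) {x : V}
    (hx : Φ x = none) :
    ∃ (n : ℕ) (q : ℕ → V), IsInducedCycle G n q ∧ q 0 = x ∧ Φ (q 1) ≠ Φ (q (n + 2)) := by
  obtain ⟨a, b, ha, hb, hab⟩ := h.colorful Φ hΦ x hx
  refine exists_isInducedCycle_of_rel (R := fun a b => Φ a ≠ Φ b) (h.preconnected_compl x)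
    (fun a ha => ha rfl) (fun a b y hab => ?_) ha hb hab
  by_contra! hc
  exact hab (hc.1.trans hc.2)

/-- By symmetry of `μ`, adjacent vertices share the weight of their common edge, so the constant at
one vertex spreads along walks. -/
theorem const_of_weight_eq (h : BalancedSystem G μ S)
    (hμ : ∀ x y z, G.Adj x y → G.Adj x z → μ x y = μ x z) :
    ∃ t, 0 < t ∧ ∀ x y, G.Adj x y → μ x y = t := by
  obtain ⟨Φ, hΦ, a, ha⟩ := h.nonempty
  obtain ⟨b, -, hab, -⟩ := h.colorful Φ hΦ a ha
  refine ⟨μ a b, (h.pos_iff a b).2 hab, fun x => ?_⟩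
  obtain ⟨W⟩ := h.preconnected x a
  induction W with
  | nil => exact fun y hy => hμ _ _ _ hy hab
  | @cons x x' a hadj _ ih =>
    intro y hy
    rw [hμ x y x' hy hadj, h.symm, ih ha hab x hadj.symm]

theorem weight_eq_of_triangle (h : BalancedSystem G μ S) {Φ : V → Option C} (hΦ : Φ ∈ S)
    {x a b : V} (hx : Φ x = none) (ha : G.Adj x a) (hb : G.Adj x b) (hadj : G.Adj a b)
    (hab : Φ a ≠ Φ b) : μ x a = μ x b := by
  refine h.weight_eq_of_exchange hΦ (h.comp_swap_mem hΦ hx ha hb hadj) hx ?_ hab (by simp) (by simp)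
    fun y hya hyb _ => ?_
  · rw [comp_apply, Equiv.swap_apply_of_ne_of_ne ha.ne hb.ne, hx]
  · rw [comp_apply, Equiv.swap_apply_of_ne_of_ne hya hyb]

/-- Two adjacent neighbors of the vacant vertex with distinct values have the same neighbors among
the other neighbors of the vacant vertex. -/
theorem adj_iff_adj_of_triangle (h : BalancedSystem G μ S) {Φ : V → Option C} (hΦ : Φ ∈ S)
    {x a b y : V} (hx : Φ x = none) (ha : G.Adj x a) (hb : G.Adj x b) (hadj : G.Adj a b)
    (hab : Φ a ≠ Φ b) (hy : G.Adj x y) (hya : y ≠ a) (hyb : y ≠ b) : G.Adj y a ↔ G.Adj y b := by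
  have hsw := h.comp_swap_mem hΦ hx ha hb hadj
  have hsx : (Φ ∘ Equiv.swap a b) x = none := by
    rw [comp_apply, Equiv.swap_apply_of_ne_of_ne ha.ne hb.ne, hx]
  -- The vacancy moves to `y` from the configurations before and after the exchange of `a` and `b`;
  -- the results differ only in that exchange.
  have key : μ y a = μ y b := by
    refine h.weight_eq_of_exchange (h.slide Φ hΦ x y hx hy) (h.slide _ hsw x y hsx hy)
      (by simpa using hx) (by simpa using hsx) ?_ ?_ ?_ ?_
    all_goals simp only [comp_apply, Equiv.swap_apply_of_ne_of_ne ha.ne' hya.symm,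
      Equiv.swap_apply_of_ne_of_ne hb.ne' hyb.symm, Equiv.swap_apply_left, Equiv.swap_apply_right]
    · exact hab
    · intro z hza hzb hyz
      by_cases hzx : z = x
      · simp [hzx, Equiv.swap_apply_of_ne_of_ne hya hyb]
      · rw [Equiv.swap_apply_of_ne_of_ne hzx hyz.ne', Equiv.swap_apply_of_ne_of_ne hza hzb]
  rw [← h.pos_iff, ← h.pos_iff, key]

/-- If each induced cycle on which the vacant vertex sees two values is a triangle, then the end of an
edge whose ends are neighbors of the vacant vertex with distinct values is adjacent to all other
neighbors of the vacant vertex. -/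
theorem adj_of_triangle (h : BalancedSystem G μ S)
    (hlen : ∀ Φ ∈ S, ∀ (n : ℕ) (q : ℕ → V), IsInducedCycle G n q → Φ (q 0) = none →
      Φ (q 1) ≠ Φ (q (n + 2)) → n = 0) {Φ : V → Option C} (hΦ : Φ ∈ S)
    {x a b y : V} (hx : Φ x = none) (ha : G.Adj x a) (hb : G.Adj x b) (hadj : G.Adj a b)
    (hab : Φ a ≠ Φ b) (hy : G.Adj x y) (hya : y ≠ a) : G.Adj a y := by
  have hab' : a ≠ b := hadj.ne
  -- Among the neighbors of `x`, the set formed by `a` and its neighbors is closed under adjacency.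
  -- If `m` and `a` have distinct values, they form a triangle with `x` to compare; otherwise `b`
  -- serves as an intermediate.
  have closed : ∀ m z, G.Adj x m → G.Adj x z → (m = a ∨ G.Adj a m) → G.Adj m z →
      (z = a ∨ G.Adj a z) := by
    intro m z hm hz hma hmz
    by_cases hza : z = a
    · exact Or.inl hza
    right
    by_cases hzb : z = b
    · rwa [hzb]
    have hz1 := h.adj_iff_adj_of_triangle hΦ hx ha hb hadj hab hz hza hzb
    rcases hma with rfl | hma
    · exact hmz
    by_cases hmb : m = b
    · subst hmb
      exact (hz1.2 hmz.symm).symm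
    by_cases hc : Φ m = Φ a
    · have hmb' : G.Adj m b :=
        (h.adj_iff_adj_of_triangle hΦ hx ha hb hadj hab hm hma.ne' hmb).1 hma.symm
      have := h.adj_iff_adj_of_triangle hΦ hx hm hb hmb' (hc ▸ hab) hz hmz.ne' hzb
      exact (hz1.2 (this.1 hmz.symm)).symm
    · have := h.adj_iff_adj_of_triangle hΦ hx hm ha hma.symm hc hz hmz.ne' hza
      exact (this.1 hmz.symm).symm
  by_contra hay
  -- The relation says that `u` is in the closed set and `v` is not. An induced cycle between such
  -- neighbors cannot be a triangle, by `closed`.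
  obtain ⟨n, q, hq, rfl, ⟨h1x, h1⟩, h2⟩ := exists_isInducedCycle_of_rel
    (R := fun u v => (G.Adj x u ∧ (u = a ∨ G.Adj a u)) ∧ ¬ (G.Adj x v ∧ (v = a ∨ G.Adj a v)))
    (h.preconnected_compl x) (fun u hu => hu.2 hu.1) (fun u v z huv => by tauto) ha hy
    ⟨⟨ha, Or.inl rfl⟩, fun hc => hc.2.elim hya hay⟩
  have hlastx : G.Adj (q 0) (q (n + 2)) := (hq.adj_zero_iff (by omega)).2 (Or.inr rfl)
  have hn : n ≠ 0 := by
    rintro rfl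
    exact h2 ⟨hlastx, closed _ _ h1x hlastx h1 ((hq.adj 1 1 (by omega)).2 (Or.inl rfl))⟩
  by_cases hne : Φ (q 1) = Φ (q (n + 2))
  · obtain ⟨c, hcx, hc1, hc⟩ : ∃ c, G.Adj (q 0) c ∧ G.Adj (q 1) c ∧ Φ c ≠ Φ (q 1) := by
      rcases h1 with h1 | h1
      · exact ⟨b, hb, h1 ▸ hadj, by rw [h1]; exact hab.symm⟩
      · by_cases hc : Φ a = Φ (q 1)
        · have hcb : Φ b ≠ Φ (q 1) := hc ▸ hab.symm
          exact ⟨b, hb, (h.adj_iff_adj_of_triangle hΦ hx ha hb hadj hab h1x h1.ne'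
            (fun he => hcb (he ▸ rfl))).1 h1.symm, hcb⟩
        · exact ⟨a, ha, h1.symm, hc⟩
    have hlast1 : q (n + 2) ≠ q 1 := fun he => by
      have := hq.eq_of_eq (by omega) (by omega) he
      omega
    refine hn (hlen _ (h.comp_swap_mem hΦ hx h1x hcx hc1) n q hq ?_ ?_)
    · rw [comp_apply, Equiv.swap_apply_of_ne_of_ne h1x.ne hcx.ne, hx]
    · rw [comp_apply, comp_apply, Equiv.swap_apply_left, Equiv.swap_apply_of_ne_of_ne hlast1, ← hne]
      · exact hc
      · rintro rfl
        exact hc hne.symm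
  · exact hn (hlen Φ hΦ n q hq hx hne)

theorem exists_triangle (h : BalancedSystem G μ S)
    (hlen : ∀ Φ ∈ S, ∀ (n : ℕ) (q : ℕ → V), IsInducedCycle G n q → Φ (q 0) = none →
      Φ (q 1) ≠ Φ (q (n + 2)) → n = 0) {Φ : V → Option C} (hΦ : Φ ∈ S) {x : V} (hx : Φ x = none) :
    ∃ a b, G.Adj x a ∧ G.Adj x b ∧ G.Adj a b ∧ Φ a ≠ Φ b := by
  obtain ⟨n, q, hq, rfl, hne⟩ := h.exists_isInducedCycle hΦ hx
  obtain rfl := hlen Φ hΦ n q hq hx hne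
  exact ⟨q 1, q 2, (hq.adj_zero_iff (by omega)).2 (Or.inl rfl),
    (hq.adj_zero_iff (by omega)).2 (Or.inr rfl), (hq.adj 1 1 (by omega)).2 (Or.inl rfl), hne⟩

/-- Once `x` is vacant, the ends `a`, `b` of a two-valued triangle at `x` are adjacent to all other
neighbors of `x`. So `y` forms a two-valued triangle with one of them and is itself adjacent to all
others. -/
theorem adj_of_adj_of_adj (h : BalancedSystem G μ S)
    (hlen : ∀ Φ ∈ S, ∀ (n : ℕ) (q : ℕ → V), IsInducedCycle G n q → Φ (q 0) = none →
      Φ (q 1) ≠ Φ (q (n + 2)) → n = 0) {x y z : V} (hy : G.Adj x y) (hz : G.Adj x z) (hyz : y ≠ z) :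
    G.Adj y z := by
  obtain ⟨Φ₀, hΦ₀, x₀, hx₀⟩ := h.nonempty
  obtain ⟨Φ, hΦ, hx⟩ := h.exists_slide_to h.preconnected hΦ₀ hx₀ x
  obtain ⟨a, b, ha, hb, hadj, hab⟩ := h.exists_triangle hlen hΦ hx
  by_cases hya : y = a
  · exact hya ▸ h.adj_of_triangle hlen hΦ hx ha hb hadj hab hz (hya ▸ hyz.symm)
  by_cases hyb : y = b
  · exact hyb ▸ h.adj_of_triangle hlen hΦ hx hb ha hadj.symm hab.symm hz (hyb ▸ hyz.symm)
  by_cases hc : Φ y = Φ a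
  · exact h.adj_of_triangle hlen hΦ hx hy hb
      (h.adj_of_triangle hlen hΦ hx hb ha hadj.symm hab.symm hy hyb).symm (hc ▸ hab) hz hyz.symm
  · exact h.adj_of_triangle hlen hΦ hx hy ha
      (h.adj_of_triangle hlen hΦ hx ha hb hadj hab hy hya).symm hc hz hyz.symm

/-- The graph of a balanced system is complete or an odd cycle, and its weights are constant. -/
theorem classification (h : BalancedSystem G μ S) :
    (∃ t, 0 < t ∧ ∀ x y, G.Adj x y → μ x y = t) ∧
      (G = ⊤ ∨ ∃ n, Even n ∧ Nonempty (SimpleGraph.cycleGraph (n + 3) ≃g G)) := by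
  by_cases hlen : ∀ Φ ∈ S, ∀ (n : ℕ) (q : ℕ → V), IsInducedCycle G n q → Φ (q 0) = none →
      Φ (q 1) ≠ Φ (q (n + 2)) → n = 0
  · refine ⟨h.const_of_weight_eq fun x y z hy hz => ?_, Or.inl ?_⟩
    · obtain ⟨Φ₀, hΦ₀, x₀, hx₀⟩ := h.nonempty
      obtain ⟨Φ, hΦ, hx⟩ := h.exists_slide_to h.preconnected hΦ₀ hx₀ x
      obtain ⟨a, b, ha, hb, -, hab⟩ := h.exists_triangle hlen hΦ hx
      have key : ∀ u v, G.Adj x u → G.Adj x v → Φ u ≠ Φ v → μ x u = μ x v := fun u v hu hv huv =>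
        h.weight_eq_of_triangle hΦ hx hu hv
          (h.adj_of_adj_of_adj hlen hu hv (ne_of_apply_ne Φ huv)) huv
      by_cases hyz : Φ y = Φ z
      · obtain ⟨c, hc, hcy⟩ : ∃ c, G.Adj x c ∧ Φ y ≠ Φ c := by
          by_cases hya : Φ y = Φ a
          · exact ⟨b, hb, hya ▸ hab⟩
          · exact ⟨a, ha, hya⟩
        rw [key y c hy hc hcy, key z c hz hc (hyz ▸ hcy)]
      · exact key y z hy hz hyz
    · ext x y
      rw [SimpleGraph.top_adj]
      refine ⟨fun he => he.ne, fun hxy => ?_⟩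
      obtain ⟨W⟩ := h.preconnected x y
      have : x = y ∨ G.Adj x y := by
        clear hxy
        induction W with
        | nil => exact Or.inl rfl
        | @cons x x' y hadj _ ih =>
          rcases ih with rfl | ih
          · exact Or.inr hadj
          · by_cases hxy : x = y
            · exact Or.inl hxy
            · exact Or.inr (h.adj_of_adj_of_adj hlen hadj.symm ih hxy)
      exact this.resolve_left hxy
  · push Not at hlen
    obtain ⟨Φ, hΦ, n, q, hq, h0, hne, hn0⟩ := hlen
    have heven := h.even_of_ne hq hΦ h0 hne
    -- `n` is even and not zero, hence at least two.
    have hspan := h.mem_range_of_ne hq (by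
      obtain ⟨m, rfl⟩ := heven
      omega) hΦ h0 hne
    refine ⟨h.const_of_weight_eq fun x y z hy hz => ?_, Or.inr ⟨n, heven, hq.nonempty_iso hspan⟩⟩
    obtain ⟨j, rfl⟩ := hspan x
    obtain ⟨Ψ, hΨ, hΨj, hΨne⟩ := h.exists_ne_shift hq hΦ h0 hne j
    have hμ := (h.induced_cycle (hq.shift j) hΨ hΨj).2 hΨne
    have key : ∀ u, G.Adj (q j) u → u = q (j + 1) ∨ u = q (j + (n + 2)) := by
      intro u hu
      have hspan' : u ∈ Set.range fun i => q (j + i) := by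
        obtain ⟨i, hi, rfl⟩ := hq.exists_lt (hspan u)
        -- Adding `j` periods to `i` makes the index at least `j`.
        obtain ⟨i', hi'⟩ : ∃ i', i + (n + 3) * j = j + i' :=
          ⟨i + (n + 2) * j, by ring⟩
        refine ⟨i', ?_⟩
        show q (j + i') = q i
        rw [← hi', ← hq.apply_mod, Nat.add_mul_mod_self_left, hq.apply_mod]
      obtain ⟨i, hi, rfl⟩ := (hq.shift j).exists_lt hspan'
      rcases (hq.adj j i hi).1 hu with rfl | rfl
      · exact Or.inl rfl
      · exact Or.inr rfl
    rcases key y hy with rfl | rfl <;> rcases key z hz with rfl | rfl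
    · rfl
    · exact hμ
    · exact hμ.symm
    · rfl

end BalancedSystem

/-! ### Primal graphs, bricks and sliding on hypergraphs -/

namespace MultiHypergraph

/-- Two vertices are adjacent in the primal graph if they are distinct and have a common edge. -/
def primal (K : MultiHypergraph.{u}) : SimpleGraph K.V where
  Adj x y := x ≠ y ∧ ∃ e, x ∈ K.inc e ∧ y ∈ K.inc e
  symm := ⟨fun _ _ h => ⟨h.1.symm, h.2.imp fun _ he => he.symm⟩⟩
  loopless := ⟨fun _ h => h.1 rfl⟩

/-- The number of edges that contain two given distinct vertices. -/
noncomputable def codegree (K : MultiHypergraph.{u}) (x y : K.V) : ℕ :=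
  {e | x ≠ y ∧ x ∈ K.inc e ∧ y ∈ K.inc e}.ncard

theorem codegree_comm (K : MultiHypergraph.{u}) (x y : K.V) : K.codegree x y = K.codegree y x := by
  unfold codegree
  congr 1
  ext e
  simp only [Set.mem_ofPred_eq]
  tauto

theorem codegree_pos_iff (K : MultiHypergraph.{u}) (x y : K.V) :
    0 < K.codegree x y ↔ K.primal.Adj x y := by
  unfold codegree
  rw [Set.ncard_pos]
  exact ⟨fun ⟨e, h, he⟩ => ⟨h, e, he⟩, fun ⟨h, e, he⟩ => ⟨e, h, he⟩⟩

theorem exists_ne_of_mem_inc (K : MultiHypergraph.{u}) (e : K.E) (x : K.V) :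
    ∃ y ∈ K.inc e, y ≠ x :=
  Set.exists_ne_of_one_lt_ncard (K.two_le_inc e) x

/-- The edges at `x` all of whose other vertices have the value `c`. -/
def monoEdges (K : MultiHypergraph.{u}) {C : Type w} (Φ : K.V → Option C) (x : K.V) (c : C) :
    Set K.E :=
  {e | x ∈ K.inc e ∧ ∀ y ∈ K.inc e, y ≠ x → Φ y = some c}

/-- The edges of `K` fiber over those of `G`; the fiber over a pair is counted by its codegree `t`,
so choosing a numbering of each fiber gives the isomorphism. -/
theorem nonempty_iso_replicate (K : MultiHypergraph.{u}) {W : Type v} [Finite W]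
    {G : SimpleGraph W} (g : K.primal ≃g G) {t : ℕ} (h2 : ∀ e, (K.inc e).ncard = 2)
    (ht : ∀ x y, K.primal.Adj x y → K.codegree x y = t) :
    Nonempty (Iso K (replicate t (ofSimpleGraph G))) := by
  have hex : ∀ e, ∃ s : G.edgeSet, ∀ x, g x ∈ s.1 ↔ x ∈ K.inc e := by
    intro e
    obtain ⟨x, y, hxy, he⟩ := Set.ncard_eq_two.1 (h2 e)
    have hadj : K.primal.Adj x y := ⟨hxy, e, by simp [he], by simp [he]⟩
    refine ⟨⟨s(g x, g y), g.map_adj_iff.2 hadj⟩, fun z => ?_⟩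
    simp [he]
  choose f hf using hex
  have hcard : ∀ s, Nonempty ({e // f e = s} ≃ Fin t) := by
    rintro ⟨s, hs⟩
    induction s using Sym2.ind with
    | _ a b =>
      obtain ⟨x, rfl⟩ := g.surjective a
      obtain ⟨y, rfl⟩ := g.surjective b
      have hadj : K.primal.Adj x y := g.map_adj_iff.1 hs
      have : Nat.card {e // f e = ⟨s(g x, g y), hs⟩} = t := by
        rw [← ht x y hadj]
        unfold codegree
        rw [← Nat.card_coe_set_eq]
        refine Nat.card_congr (Equiv.subtypeEquivRight fun e => ?_)
        constructor
        · intro he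
          have h1 := hf e x
          have h2 := hf e y
          rw [he] at h1 h2
          exact ⟨hadj.ne, h1.1 (by simp), h2.1 (by simp)⟩
        · rintro ⟨hne, hx, hy⟩
          refine Subtype.ext ?_
          exact (Sym2.mem_and_mem_iff (fun h => hne (g.injective h))).1
            ⟨(hf e x).2 hx, (hf e y).2 hy⟩
      rw [← this]
      exact ⟨Finite.equivFin _⟩
  refine ⟨⟨g.toEquiv, (Equiv.sigmaFiberEquiv f).symm.trans
    ((Equiv.sigmaCongrRight fun s => (hcard s).some).trans (Equiv.sigmaEquivProd _ _)), fun e => ?_⟩⟩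
  show {w | w ∈ (f e).1} = _
  ext w
  obtain ⟨x, rfl⟩ := g.surjective w
  rw [Set.mem_ofPred_eq, hf]
  exact (g.injective.mem_set_image).symm

theorem isBrick_of_primal (K : MultiHypergraph.{u}) [Nonempty K.V] {t : ℕ} (ht0 : 0 < t)
    (h2 : ∀ e, (K.inc e).ncard = 2) (ht : ∀ x y, K.primal.Adj x y → K.codegree x y = t)
    (h : K.primal = ⊤ ∨ ∃ n, Even n ∧ Nonempty (SimpleGraph.cycleGraph (n + 3) ≃g K.primal)) :
    K.IsBrick := by
  rcases h with h | ⟨n, hn, ⟨g⟩⟩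
  · refine Or.inr ⟨t, Nat.card K.V, ht0, Nat.card_pos, ?_⟩
    refine K.nonempty_iso_replicate ⟨Finite.equivFin K.V, fun {a b} => ?_⟩ h2 ht
    simp [h]
  · exact Or.inl ⟨t, n + 3, ht0, by omega, hn.add_odd (by decide),
      K.nonempty_iso_replicate g.symm h2 ht⟩

/-- A sliding system on a hypergraph in which the edges at a vacant vertex are monochromatic in
numbers that do not depend on the configuration. -/
structure MonoSystem (K : MultiHypergraph.{u}) {C : Type w} [DecidableEq K.V]
    (S : Set (K.V → Option C)) : Prop extends SlidingSystem K.primal S where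
  mono : ∀ Φ ∈ S, ∀ x, Φ x = none → ∀ e, x ∈ K.inc e → ∃ c, e ∈ K.monoEdges Φ x c
  balanced : ∀ Φ ∈ S, ∀ Ψ ∈ S, ∀ x, Φ x = none → Ψ x = none → ∀ c,
    (K.monoEdges Φ x c).ncard = (K.monoEdges Ψ x c).ncard

/-- Double counting: an edge of size two at `x` has exactly one other end. This turns balance of
monochromatic edges into balance of codegree weights. -/
theorem ncard_monoEdges_eq_sum (K : MultiHypergraph.{u}) [Fintype K.V] {C : Type w}
    [DecidableEq C] (h2 : ∀ e, (K.inc e).ncard = 2) (Φ : K.V → Option C) (x : K.V) (c : C) :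
    (K.monoEdges Φ x c).ncard = ∑ y, if Φ y = some c then K.codegree x y else 0 := by
  classical
  have := Fintype.ofFinite K.E
  have h1 : ∀ y, (if Φ y = some c then K.codegree x y else 0) =
      ∑ e, if Φ y = some c ∧ x ≠ y ∧ x ∈ K.inc e ∧ y ∈ K.inc e then 1 else 0 := by
    intro y
    by_cases hy : Φ y = some c
    · rw [if_pos hy, codegree, Set.ncard_eq_toFinset_card', ← Finset.card_filter]
      congr 1
      ext e
      simp [hy]
    · simp [hy]
  rw [Finset.sum_congr rfl fun y _ => h1 y, Finset.sum_comm, Set.ncard_eq_toFinset_card']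
  have h3 : (K.monoEdges Φ x c).toFinset = Finset.univ.filter (fun e => e ∈ K.monoEdges Φ x c) := by
    ext
    simp
  rw [h3, Finset.card_filter]
  refine Finset.sum_congr rfl fun e _ => ?_
  by_cases hx : x ∈ K.inc e
  · obtain ⟨z, hz⟩ : ∃ z, K.inc e \ {x} = {z} := by
      rw [← Set.ncard_eq_one, Set.ncard_sdiff_singleton_of_mem hx, h2]
    have hmem : ∀ y, (y ∈ K.inc e ∧ y ≠ x) ↔ y = z := fun y => by
      have := Set.ext_iff.1 hz y
      simpa using this
    have hz' := (hmem z).2 rfl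
    rw [Finset.sum_eq_single z]
    · refine if_congr ⟨fun h => ⟨h.2 z hz'.1 hz'.2, hz'.2.symm, hx, hz'.1⟩, fun h => ⟨hx, ?_⟩⟩ rfl rfl
      intro y hy hyx
      rw [(hmem y).1 ⟨hy, hyx⟩]
      exact h.1
    · intro y _ hyz
      rw [if_neg]
      rintro ⟨-, hxy, -, hy⟩
      exact hyz ((hmem y).1 ⟨hy, hxy.symm⟩)
    · simp
  · rw [if_neg fun h => hx h.1]
    simp [hx]

namespace MonoSystem

variable {K : MultiHypergraph.{u}} {C : Type w} [DecidableEq K.V] {S : Set (K.V → Option C)}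

theorem isBrick_or_const (h : K.MonoSystem S) (hK : K.primal.Preconnected)
    (hK' : ∀ x, (K.primal.induce {x}ᶜ).Preconnected) (hS : ∃ Φ ∈ S, ∃ x, Φ x = none) :
    K.IsBrick ∨ ∃ c, ∀ Φ ∈ S, ∀ x y, Φ x = none → y ≠ x → Φ y = some c := by
  classical
  have := Fintype.ofFinite K.V
  obtain ⟨Φ₀, hΦ₀, x₀, hx₀⟩ := hS
  have : Nonempty K.V := ⟨x₀⟩
  rcases subsingleton_or_nontrivial K.V with hsub | hnon
  · have hE : ∀ e : K.E, False := fun e => by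
      obtain ⟨y, -, hy⟩ := K.exists_ne_of_mem_inc e x₀
      exact hy (Subsingleton.elim _ _)
    refine Or.inl (K.isBrick_of_primal one_pos (fun e => (hE e).elim)
      (fun x y hxy => absurd (Subsingleton.elim x y) hxy.ne) (Or.inl ?_))
    ext x y
    simp [Subsingleton.elim x y]
  have hnbr : ∀ x, ∃ y, K.primal.Adj x y := fun x => by
    obtain ⟨y, hy⟩ := exists_ne x
    obtain ⟨W⟩ := hK x y
    cases W with
    | nil => exact absurd rfl hy
    | cons hadj _ => exact ⟨_, hadj⟩
  by_cases hconst : ∃ Φ ∈ S, ∃ x c, Φ x = none ∧ ∀ y, K.primal.Adj x y → Φ y = some c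
  · obtain ⟨Φ, hΦ, x, c, hx, hc⟩ := hconst
    right
    refine ⟨c, fun Ψ hΨ a b ha hb => h.eq_of_forall_adj hK ?_ hΨ ha hb⟩
    have key : ∀ Ψ ∈ S, Ψ x = none → ∀ y, K.primal.Adj x y → Ψ y = some c := by
      rintro Ψ hΨ hΨx y ⟨hxy, e, hex, hey⟩
      -- In `Φ` all edges at `x` are monochromatic in `c`; by balance `Ψ` has equally many such
      -- edges, which are then again all edges at `x`.
      have hall : K.monoEdges Φ x c = {e | x ∈ K.inc e} := by
        ext e
        exact ⟨fun he => he.1, fun he => ⟨he, fun y hy hyx => hc y ⟨hyx.symm, e, he, hy⟩⟩⟩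
      have heq : K.monoEdges Ψ x c = {e | x ∈ K.inc e} := by
        refine Set.eq_of_subset_of_ncard_le (fun e he => he.1) ?_ (Set.toFinite _)
        rw [← hall, h.balanced Φ hΦ Ψ hΨ x hx hΨx c]
      have he : e ∈ K.monoEdges Ψ x c := heq ▸ hex
      exact he.2 y hey hxy.symm
    intro Ψ hΨ a b ha hab
    exact h.forall_adj_of_exists hK hK' key a Ψ hΨ ha b hab
  · left
    push Not at hconst
    have h2 : ∀ e, (K.inc e).ncard = 2 := by
      intro e
      refine le_antisymm ?_ (K.two_le_inc e)
      by_contra! hlt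
      obtain ⟨x, hx, -⟩ := K.exists_ne_of_mem_inc e x₀
      obtain ⟨Φ, hΦ, hΦx⟩ := h.exists_slide_to hK hΦ₀ hx₀ x
      obtain ⟨c, hc⟩ := h.mono Φ hΦ x hΦx e hx
      -- The vacancy leaves `x` through a neighbor of a value other than `c` and returns to `e` at
      -- `t`. Now `x` has that value while a third vertex `s` of `e` still has `c`, so `e` is not
      -- monochromatic at the vacant `t`.
      obtain ⟨y, hxy, hy⟩ := hconst Φ hΦ x c hΦx
      obtain ⟨z, hze, hzx⟩ := K.exists_ne_of_mem_inc e x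
      obtain ⟨t, hte, htx, hd⟩ := h.exists_detour (hK' x) hxy hze hzx
      obtain ⟨Ψ, hΨ, hΨt, hΨx, hout⟩ := hd Φ hΦ hΦx
      obtain ⟨c', hc'⟩ := h.mono Ψ hΨ t hΨt e hte
      obtain ⟨s, hse, hs⟩ : ∃ s ∈ K.inc e, s ∉ ({x, t} : Set K.V) := by
        by_contra! hs
        have := Set.ncard_le_ncard (s := K.inc e) (t := {x, t}) hs (Set.toFinite _)
        rw [Set.ncard_pair htx.symm] at this
        omega
      simp only [Set.mem_insert_iff, Set.mem_singleton_iff, not_or] at hs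
      have e1 : Ψ s = Φ s := hout s hse hs.1 hs.2
      rw [hc.2 s hse hs.1, hc'.2 s hse hs.2, ← hc'.2 x hx htx.symm, hΨx] at e1
      exact hy e1
    have hB : BalancedSystem K.primal K.codegree S :=
      { h.toSlidingSystem with
        preconnected := hK
        preconnected_compl := hK'
        nonempty := ⟨Φ₀, hΦ₀, x₀, hx₀⟩
        symm := K.codegree_comm
        pos_iff := K.codegree_pos_iff
        balanced := by
          intro Φ hΦ Ψ hΨ x hx hx' o
          cases o with
          | none =>
            refine Finset.sum_congr rfl fun y _ => ?_
            by_cases hyx : y = x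
            · rw [hyx, hx, hx']
            · rw [if_neg fun hy => hyx (h.unique Φ hΦ y x hy hx),
                if_neg fun hy => hyx (h.unique Ψ hΨ y x hy hx')]
          | some c =>
            rw [← K.ncard_monoEdges_eq_sum h2, ← K.ncard_monoEdges_eq_sum h2,
              h.balanced Φ hΦ Ψ hΨ x hx hx' c]
        colorful := by
          intro Φ hΦ x hx
          obtain ⟨y, hxy⟩ := hnbr x
          have hy : Φ y ≠ none := fun hy => hxy.ne (h.unique Φ hΦ x y hx hy)
          obtain ⟨c, hc⟩ := Option.ne_none_iff_exists'.1 hy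
          obtain ⟨z, hxz, hz⟩ := hconst Φ hΦ x c hx
          exact ⟨y, z, hxy, hxz, fun he => hz (he ▸ hc)⟩ }
    obtain ⟨⟨t, ht0, ht⟩, hG⟩ := hB.classification
    exact K.isBrick_of_primal ht0 h2 ht hG

end MonoSystem

end MultiHypergraph

/-! ### Connectivity, separating vertices and blocks -/

namespace MultiHypergraph

theorem HyperpathBetween.reachable {K : MultiHypergraph.{u}} {x y : K.V}
    (h : K.HyperpathBetween x y) : K.primal.Reachable x y := by
  obtain ⟨q, p, e, hp, -, he, rfl, rfl⟩ := h
  suffices ∀ j, K.primal.Reachable (p 0) (p j) from this _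
  intro j
  induction j using Fin.induction with
  | zero => exact SimpleGraph.Reachable.refl _
  | succ j ih =>
    refine ih.trans (SimpleGraph.Adj.reachable ⟨fun h => ?_, e j, he j⟩)
    exact (Fin.castSucc_lt_succ (i := j)).ne (hp h)

/-- On a shortest path the chosen edges are distinct: an edge used at steps `i < j` would be a
shortcut from vertex `i` to vertex `j + 1`. -/
theorem hyperpathBetween_of_reachable {K : MultiHypergraph.{u}} {x y : K.V}
    (h : K.primal.Reachable x y) : K.HyperpathBetween x y := by
  obtain ⟨P, hP, hlen⟩ := h.exists_path_of_dist
  have hV := hP.isVertexPath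
  have hex : ∀ j : Fin P.length, ∃ e, P.getVert j ∈ K.inc e ∧ P.getVert (j + 1) ∈ K.inc e :=
    fun j => (hV.adj j j.2).2
  choose e he using hex
  have key : ∀ i j : Fin P.length, i < j → e i ≠ e j := by
    intro i j hij heq
    have hij' : i.1 < j.1 := hij
    have hadj : K.primal.Adj (P.getVert i) (P.getVert (j + 1)) := by
      refine ⟨fun h => ?_, e i, (he i).1, heq ▸ (he j).2⟩
      have := hV.inj i (j + 1) (by omega) (by omega) h
      omega
    have := SimpleGraph.dist_le ((P.take i).append (.cons hadj (P.drop (j + 1))))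
    rw [SimpleGraph.Walk.length_append, SimpleGraph.Walk.length_cons, P.take_length,
      P.drop_length] at this
    omega
  refine ⟨P.length, fun j => P.getVert j, e, fun i j hij => ?_, fun i j hij => ?_, fun j => ?_,
    by simp, by simp⟩
  · exact Fin.ext (hV.inj i j (by omega) (by omega) hij)
  · rcases lt_trichotomy i j with h | h | h
    · exact absurd hij (key i j h)
    · exact h
    · exact absurd hij.symm (key j i h)
  · simpa using he j

theorem connected_iff_primal {K : MultiHypergraph.{u}} : K.Connected ↔ K.primal.Connected := by
  rw [SimpleGraph.connected_iff]
  exact ⟨fun h => ⟨fun x y => (h.2 x y).reachable, h.1⟩,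
    fun h => ⟨h.2, fun x y => hyperpathBetween_of_reachable (h.1 x y)⟩⟩

/-- The vertex is removed from the primal graph, so an edge through `x` still joins its other
vertices. This matches the definition, where each edge must lie wholly in one side. For the
converse, the sides are a component with `x` added and its complement. -/
theorem exists_isSeparatingVertex_iff {K : MultiHypergraph.{u}} {x : K.V} :
    K.IsSeparatingVertex x ↔ ¬ (K.primal.induce {x}ᶜ).Preconnected := by
  constructor
  · rintro ⟨X, Y, hv, he, hXY, hX, hY⟩ hcon
    obtain ⟨a, ha, hax⟩ := Set.exists_ne_of_one_lt_ncard hX x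
    obtain ⟨b, hb, hbx⟩ := Set.exists_ne_of_one_lt_ncard hY x
    have hinter : ∀ z, z ∈ X → z ∈ Y → z = x := fun z h1 h2 => by
      have : z ∈ X ∩ Y := ⟨h1, h2⟩
      rwa [hXY] at this
    obtain ⟨W⟩ := hcon ⟨a, hax⟩ ⟨b, hbx⟩
    obtain ⟨d, -, h1, h2⟩ := W.exists_boundary_dart {z | z.1 ∈ X} ha
      fun h => hbx (hinter b h hb)
    obtain ⟨-, e, he1, he2⟩ : K.primal.Adj d.fst.1 d.snd.1 := d.adj
    have : e ∈ (K.inducedSub X).edges ∪ (K.inducedSub Y).edges := he ▸ Set.mem_univ e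
    rcases this with h | h
    · exact h2 (h he2)
    · exact d.fst.2 (hinter _ h1 (h he1))
  · intro hcon
    simp only [SimpleGraph.Preconnected, not_forall] at hcon
    obtain ⟨a, b, hab⟩ := hcon
    let R : Set K.V := {z | ∃ hz : z ≠ x, (K.primal.induce {x}ᶜ).Reachable a ⟨z, hz⟩}
    have hxR : x ∉ R := fun ⟨h, _⟩ => h rfl
    have haR : a.1 ∈ R := ⟨a.2, SimpleGraph.Reachable.refl _⟩
    have hbR : b.1 ∉ R := fun ⟨_, h⟩ => hab h
    refine ⟨insert x R, Rᶜ, ?_, ?_, ?_, ?_, ?_⟩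
    · ext z
      simp only [inducedSub, Set.mem_union, Set.mem_insert_iff, Set.mem_compl_iff, Set.mem_univ,
        iff_true]
      tauto
    · refine Set.eq_univ_of_forall fun e => ?_
      by_contra hne
      simp only [inducedSub, Set.mem_union, Set.mem_ofPred_eq, not_or, Set.not_subset] at hne
      obtain ⟨⟨z, hze, hz⟩, z', hze', hz'⟩ := hne
      rw [Set.mem_insert_iff, not_or] at hz
      rw [Set.mem_compl_iff, not_not] at hz'
      obtain ⟨hzx', hr⟩ := hz'
      refine hz.2 ⟨hz.1, hr.trans (SimpleGraph.Adj.reachable ?_)⟩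
      refine (⟨fun h => ?_, e, hze', hze⟩ : K.primal.Adj z' z)
      exact hz.2 (h ▸ ⟨hzx', hr⟩)
    · ext z
      simp only [Set.mem_inter_iff, Set.mem_insert_iff, Set.mem_compl_iff, Set.mem_singleton_iff]
      constructor
      · tauto
      · rintro rfl
        exact ⟨Or.inl rfl, hxR⟩
    · exact (Set.one_lt_ncard (Set.toFinite _)).2
        ⟨x, Or.inl rfl, a, Or.inr haR, fun h => a.2 h.symm⟩
    · exact (Set.one_lt_ncard (Set.toFinite _)).2 ⟨x, hxR, b, hbR, fun h => b.2 h.symm⟩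

theorem not_exists_isSeparatingVertex_iff {K : MultiHypergraph.{u}} :
    (¬ ∃ x, K.IsSeparatingVertex x) ↔ ∀ x, (K.primal.induce {x}ᶜ).Preconnected := by
  simp [exists_isSeparatingVertex_iff]

theorem Sub.primal_reachable_mono {H : MultiHypergraph.{u}} {A B : H.Sub} (h : A ≤ B)
    {x y : A.verts} (hxy : A.toHypergraph.primal.Reachable x y) :
    B.toHypergraph.primal.Reachable ⟨x, h.1 x.2⟩ ⟨y, h.1 y.2⟩ := by
  let f : A.toHypergraph.primal →g B.toHypergraph.primal :=
    { toFun := fun z => ⟨z.1, h.1 z.2⟩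
      map_rel' := by
        rintro a b ⟨hab, e, ha, hb⟩
        exact ⟨fun he => hab (Subtype.ext (congrArg (fun z : B.verts => z.1) he)), ⟨e.1, h.2 e.2⟩, ha, hb⟩ }
  exact hxy.map f

theorem Sub.primal_compl_reachable_mono {H : MultiHypergraph.{u}} {A B : H.Sub} (h : A ≤ B)
    (v : B.verts) (hA : A.toHypergraph.primal.Preconnected)
    (hA' : ∀ x, (A.toHypergraph.primal.induce {x}ᶜ).Preconnected) {x y : A.verts}
    (hx : x.1 ≠ v.1) (hy : y.1 ≠ v.1) :
    (B.toHypergraph.primal.induce {v}ᶜ).Reachable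
      ⟨⟨x, h.1 x.2⟩, fun he => hx (congrArg Subtype.val he)⟩
      ⟨⟨y, h.1 y.2⟩, fun he => hy (congrArg Subtype.val he)⟩ := by
  by_cases hv : v.1 ∈ A.verts
  · let f : A.toHypergraph.primal.induce {(⟨v.1, hv⟩ : A.verts)}ᶜ →g
        B.toHypergraph.primal.induce {v}ᶜ :=
      { toFun := fun z => ⟨⟨z.1.1, h.1 z.1.2⟩,
          fun he => z.2 (Subtype.ext (congrArg (fun z : B.verts => z.1) he))⟩
        map_rel' := by
          rintro a b ⟨hab, e, ha, hb⟩
          exact ⟨fun he => hab (Subtype.ext (congrArg (fun z : B.verts => z.1) he)), ⟨e.1, h.2 e.2⟩, ha, hb⟩ }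
    exact (hA' ⟨v.1, hv⟩ ⟨x, fun he => hx (congrArg Subtype.val he)⟩
      ⟨y, fun he => hy (congrArg Subtype.val he)⟩).map f
  · let f : A.toHypergraph.primal →g B.toHypergraph.primal.induce {v}ᶜ :=
      { toFun := fun z => ⟨⟨z.1, h.1 z.2⟩, fun he => hv (congrArg Subtype.val he ▸ z.2)⟩
        map_rel' := by
          rintro a b ⟨hab, e, ha, hb⟩
          exact ⟨fun he => hab (Subtype.ext (congrArg (fun z : B.verts => z.1) he)), ⟨e.1, h.2 e.2⟩, ha, hb⟩ }
    exact (hA x y).map f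

namespace IsBlock

variable {H : MultiHypergraph.{u}} {B : H.Sub}

theorem primal_connected (hB : IsBlock B) : B.toHypergraph.primal.Connected :=
  connected_iff_primal.1 hB.1.1

theorem primal_compl_preconnected (hB : IsBlock B) (x : B.verts) :
    (B.toHypergraph.primal.induce {x}ᶜ).Preconnected :=
  not_exists_isSeparatingVertex_iff.1 hB.1.2 x

/-- An edge with two vertices in a block belongs to the block. -/
theorem mem_edges (hB : IsBlock B) {e : H.E} {x y : H.V} (hxy : x ≠ y) (hx : x ∈ B.verts)
    (hy : y ∈ B.verts) (hxe : x ∈ H.inc e) (hye : y ∈ H.inc e) : e ∈ B.edges := by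
  let A : H.Sub :=
    { verts := B.verts ∪ H.inc e
      edges := insert e B.edges
      inc_subset := by
        rintro e' (rfl | he')
        · exact Set.subset_union_right
        · exact (B.inc_subset e' he').trans Set.subset_union_left }
  have hBA : B ≤ A := ⟨Set.subset_union_left, Set.subset_insert _ _⟩
  have hadj : ∀ a b : A.verts, a.1 ∈ H.inc e → b.1 ∈ H.inc e → a ≠ b →
      A.toHypergraph.primal.Adj a b := fun a b ha hb hab =>
    ⟨hab, ⟨e, Set.mem_insert _ _⟩, ha, hb⟩
  have hcon := hB.primal_connected.preconnected
  have hA : A.toHypergraph.Connected ∧ ¬ ∃ x, A.toHypergraph.IsSeparatingVertex x := by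
    rw [connected_iff_primal, not_exists_isSeparatingVertex_iff, SimpleGraph.connected_iff]
    refine ⟨⟨?_, ⟨⟨x, hBA.1 hx⟩⟩⟩, ?_⟩
    · have base : ∀ a : A.verts, A.toHypergraph.primal.Reachable ⟨x, hBA.1 hx⟩ a := by
        rintro ⟨a, ha | ha⟩
        · exact Sub.primal_reachable_mono hBA (hcon ⟨x, hx⟩ ⟨a, ha⟩)
        · by_cases hax : a = x
          · subst hax
            exact SimpleGraph.Reachable.refl _
          · exact (hadj _ _ hxe ha fun he => hax (congrArg Subtype.val he).symm).reachable
      exact fun a b => (base a).symm.trans (base b)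
    · intro v
      -- Of the two vertices that `e` shares with `B`, one survives the deletion of `v` and links
      -- the rest of `e` to the rest of `B`.
      obtain ⟨b, hb, hbe, hbv⟩ : ∃ b, b ∈ B.verts ∧ b ∈ H.inc e ∧ b ≠ v.1 := by
        by_cases hxv : x = v.1
        · exact ⟨y, hy, hye, fun h => hxy (hxv.trans h.symm)⟩
        · exact ⟨x, hx, hxe, hxv⟩
      have hbv' : (⟨b, hBA.1 hb⟩ : A.verts) ∈ ({v}ᶜ : Set A.verts) :=
        fun he => hbv (congrArg Subtype.val he)
      have base : ∀ a : ({v}ᶜ : Set A.verts),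
          (A.toHypergraph.primal.induce {v}ᶜ).Reachable ⟨⟨b, hBA.1 hb⟩, hbv'⟩ a := by
        rintro ⟨⟨a, ha | ha⟩, hav⟩
        · exact Sub.primal_compl_reachable_mono hBA v hcon hB.primal_compl_preconnected
            (x := ⟨b, hb⟩) (y := ⟨a, ha⟩) hbv fun he => hav (Subtype.ext he)
        · by_cases hab : a = b
          · subst hab
            exact SimpleGraph.Reachable.refl _
          · refine SimpleGraph.Adj.reachable ?_
            exact hadj ⟨b, hBA.1 hb⟩ ⟨a, Or.inr ha⟩ hbe ha
              fun he => hab (congrArg Subtype.val he).symm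
      exact fun a b => (base a).symm.trans (base b)
  exact (hB.2 hA hBA).2 (Set.mem_insert _ _)

theorem eq_inducedSub (hB : IsBlock B) : B = H.inducedSub B.verts := by
  refine Sub.ext rfl (Set.Subset.antisymm B.inc_subset fun e he => ?_)
  obtain ⟨x, y, hx, hy, hxy⟩ := (Set.one_lt_ncard_iff (Set.toFinite _)).1 (H.two_le_inc e)
  exact hB.mem_edges hxy (he hx) (he hy) hx hy

end IsBlock

end MultiHypergraph

/-! ### Induced subhypergraphs and hereditary properties -/

namespace MultiHypergraph

/-- The inverse of an isomorphism. -/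
def Iso.symm {H : MultiHypergraph.{u}} {K : MultiHypergraph.{v}} (f : Iso H K) : Iso K H where
  onV := f.onV.symm
  onE := f.onE.symm
  inc_eq e := by
    have h := f.inc_eq (f.onE.symm e)
    rw [Equiv.apply_symm_apply] at h
    rw [h, Equiv.symm_image_image]

theorem induce_induce_iso (H : MultiHypergraph.{u}) (X : Set H.V) (Y : Set (H.induce X).V) :
    Nonempty (Iso ((H.induce X).induce Y) (H.induce (Subtype.val '' Y))) := by
  have hmem : ∀ e : (H.induce X).E, (H.induce X).inc e ⊆ Y ↔ H.inc e.1 ⊆ Subtype.val '' Y := by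
    intro e
    constructor
    · intro h x hx
      exact ⟨⟨x, e.2 hx⟩, h hx, rfl⟩
    · rintro h ⟨x, hxX⟩ hx
      obtain ⟨y, hy, hyx⟩ := h hx
      obtain rfl : y = ⟨x, hxX⟩ := Subtype.ext hyx
      exact hy
  have hsub : Subtype.val '' Y ⊆ X := by
    rintro _ ⟨y, -, rfl⟩
    exact y.2
  let f : Y ≃ (Subtype.val '' Y : Set H.V) := Equiv.Set.image _ Y Subtype.val_injective
  refine ⟨⟨f, ⟨fun e => ⟨e.1.1, (hmem e.1).1 e.2⟩,
      fun e => ⟨⟨e.1, e.2.trans hsub⟩, (hmem ⟨e.1, e.2.trans hsub⟩).2 e.2⟩,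
      fun e => rfl, fun e => rfl⟩, fun e => Set.ext fun z => ?_⟩⟩
  constructor
  · intro hz
    obtain ⟨y, rfl⟩ := f.surjective z
    exact ⟨y, hz, rfl⟩
  · rintro ⟨y, hy, rfl⟩
    exact hy

theorem degree_toHypergraph {H : MultiHypergraph.{u}} (A : H.Sub) (x : A.toHypergraph.V) :
    A.toHypergraph.degree x = {e | x.1 ∈ H.inc e ∧ e ∈ A.edges}.ncard := by
  have himg : {e | x.1 ∈ H.inc e ∧ e ∈ A.edges} =
      Subtype.val '' {e : A.toHypergraph.E | x ∈ A.toHypergraph.inc e} := by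
    ext e
    constructor
    · rintro ⟨hx, he⟩
      exact ⟨⟨e, he⟩, hx, rfl⟩
    · rintro ⟨e, he, rfl⟩
      exact ⟨he, e.2⟩
  rw [himg, Set.ncard_image_of_injective _ Subtype.val_injective]
  rfl

theorem nonempty_iso_of_isEmpty (H K : MultiHypergraph.{u}) [IsEmpty H.V] [IsEmpty K.V] :
    Nonempty (Iso H K) := by
  have hE : ∀ (G : MultiHypergraph.{u}) [IsEmpty G.V], IsEmpty G.E := fun G _ => ⟨fun e => by
    have h := G.two_le_inc e
    rw [Set.eq_empty_of_isEmpty (G.inc e), Set.ncard_empty] at h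
    omega⟩
  have := hE H
  have := hE K
  exact ⟨⟨Equiv.equivOfIsEmpty _ _, Equiv.equivOfIsEmpty _ _, fun e => isEmptyElim e⟩⟩

theorem minDegree_le_degree (H : MultiHypergraph.{u}) (x : H.V) : H.minDegree ≤ H.degree x :=
  ciInf_le (OrderBot.bddBelow _) x

/-- A family of vertex sets that is closed under subsets and under insertion of a vertex that has
degree less than `r` in the resulting set. -/
structure DegreeClosed (H : MultiHypergraph.{u}) (r : ℕ) (good : Set H.V → Prop) : Prop where
  empty : good ∅
  mono : ∀ X Y, X ⊆ Y → good Y → good X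
  insert : ∀ x X, good X → {e | x ∈ H.inc e ∧ H.inc e ⊆ Insert.insert x X}.ncard < r →
    good (Insert.insert x X)

end MultiHypergraph

namespace HypergraphProperty

open MultiHypergraph

variable {P : HypergraphProperty.{u}} {H : MultiHypergraph.{u}}

theorem Hereditary.induce_mono (hP : P.Hereditary) {X Y : Set H.V} (hXY : X ⊆ Y)
    (hY : H.induce Y ∈ P.carrier) : H.induce X ∈ P.carrier := by
  have h1 := P.iso_closed _ _ (H.induce_induce_iso Y (Subtype.val ⁻¹' X))
    (hP _ hY (Subtype.val ⁻¹' X))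
  have h2 : (Subtype.val '' (Subtype.val ⁻¹' X : Set Y) : Set H.V) = X := by
    rw [Subtype.image_preimage_coe, Set.inter_eq_right.2 hXY]
  exact h2 ▸ h1

theorem induce_deleteVertex_mem (X : Set H.V) (x : X)
    (h : H.induce (X \ {x.1}) ∈ P.carrier) : (H.induce X).deleteVertex x ∈ P.carrier := by
  obtain ⟨f⟩ := H.induce_induce_iso X {x}ᶜ
  have himg : (Subtype.val '' ({x}ᶜ : Set X) : Set H.V) = X \ {x.1} := by
    ext z
    constructor
    · rintro ⟨y, hy, rfl⟩
      exact ⟨y.2, fun he => hy (Subtype.ext he)⟩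
    · rintro ⟨hz, hzx⟩
      exact ⟨⟨z, hz⟩, fun he => hzx (congrArg Subtype.val he), rfl⟩
  exact P.iso_closed _ _ ⟨f.symm⟩ (himg ▸ h)

theorem d_le_minDegree (hH : H ∈ P.forbidden) : P.d ≤ H.minDegree :=
  Nat.sInf_le ⟨H, hH, rfl⟩

theorem Hereditary.empty_mem (hP : P.Hereditary) (hnt : ∃ K, K ∈ P.carrier) :
    H.induce ∅ ∈ P.carrier := by
  obtain ⟨K, hK⟩ := hnt
  have h : ∀ G : MultiHypergraph.{u}, IsEmpty (G.induce ∅).V := fun G => Set.isEmpty_coe_sort.2 rfl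
  have := h H
  have := h K
  exact P.iso_closed _ _ (nonempty_iso_of_isEmpty _ _) (hP K hK ∅)

/-- If adding `x` left `P`, a minimal bad subset `Y` of the enlarged set would contain `x` and
induce a member of `F(P)`, so `x` would already have degree at least `d(P)` in `H[Y]`. -/
theorem Hereditary.degreeClosed (hP : P.Hereditary) (hnt : ∃ K, K ∈ P.carrier)
    (H : MultiHypergraph.{u}) : H.DegreeClosed P.d fun X => H.induce X ∈ P.carrier where
  empty := hP.empty_mem hnt
  mono _ _ h := hP.induce_mono h
  insert x X hX hlt := by
    by_contra hbad
    obtain ⟨Y, hYX, hY⟩ := exists_minimal_le_of_wellFoundedLT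
      (fun Y : Set H.V => H.induce Y ∉ P.carrier) _ hbad
    have hYX' : Y ⊆ Insert.insert x X := hYX
    have hxY : x ∈ Y := by
      by_contra hxY
      refine hY.1 (hP.induce_mono (fun y hy => ?_) hX)
      exact (hYX' hy).resolve_left fun he => hxY (he ▸ hy)
    have hforb : H.induce Y ∈ P.forbidden := by
      refine ⟨hY.1, fun y => induce_deleteVertex_mem Y y ?_⟩
      by_contra hne
      exact (hY.2 hne Set.sdiff_subset y.2).2 rfl
    have h1 := (d_le_minDegree hforb).trans ((H.induce Y).minDegree_le_degree ⟨x, hxY⟩)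
    have h3 := degree_toHypergraph (H.inducedSub Y) ⟨x, hxY⟩
    have h2 : {e | x ∈ H.inc e ∧ H.inc e ⊆ Y}.ncard ≤
        {e | x ∈ H.inc e ∧ H.inc e ⊆ Insert.insert x X}.ncard :=
      Set.ncard_le_ncard (fun e he => ⟨he.1, he.2.trans hYX'⟩) (Set.toFinite _)
    exact absurd ((h1.trans h3.le).trans h2) (not_le.2 hlt)

end HypergraphProperty

/-! ### Partial colorings with one vacant vertex -/

namespace MultiHypergraph

variable {H : MultiHypergraph.{u}} {r : ℕ} {good : Set H.V → Prop} {C : Type w} {L : H.V → Set C}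

theorem eq_of_mem_monoEdges {Φ : H.V → Option C} {x : H.V} {c c' : C} {e : H.E}
    (h : e ∈ H.monoEdges Φ x c) (h' : e ∈ H.monoEdges Φ x c') : c = c' := by
  obtain ⟨y, hy, hyx⟩ := H.exists_ne_of_mem_inc e x
  exact Option.some_injective _ ((h.2 y hy hyx).symm.trans (h'.2 y hy hyx))

/-- If there are at least `r` monochromatic edges at `x` in each color of the list of `x`, then there
are exactly `r` in each color, and they are all edges at `x`. -/
theorem monoEdges_of_forall_le (hr : 0 < r) {Φ : H.V → Option C} {x : H.V}
    (hL : (H.degree x : ℕ∞) ≤ (r : ℕ∞) * (L x).encard)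
    (hle : ∀ c ∈ L x, r ≤ (H.monoEdges Φ x c).ncard) :
    (∀ c ∈ L x, (H.monoEdges Φ x c).ncard = r) ∧
      ∀ e, x ∈ H.inc e → ∃ c ∈ L x, e ∈ H.monoEdges Φ x c := by
  classical
  have := Fintype.ofFinite H.E
  -- Since `r > 0`, each color of the list occurs on some vertex of `H`; so the list is finite and
  -- the count takes place in `ℕ`.
  have hfin : (L x).Finite := by
    refine Set.Finite.subset ((Set.finite_range Φ).preimage (Option.some_injective C).injOn) ?_
    intro c hc
    obtain ⟨e, he⟩ := Set.nonempty_of_ncard_ne_zero (by have := hle c hc; omega :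
      (H.monoEdges Φ x c).ncard ≠ 0)
    obtain ⟨y, hy, hyx⟩ := H.exists_ne_of_mem_inc e x
    exact ⟨y, he.2 y hy hyx⟩
  have hL' : H.degree x ≤ r * hfin.toFinset.card := by
    rw [hfin.encard_eq_coe_toFinset_card] at hL
    exact_mod_cast hL
  have hunion : (hfin.toFinset.biUnion fun c => (H.monoEdges Φ x c).toFinset).card =
      ∑ c ∈ hfin.toFinset, (H.monoEdges Φ x c).ncard := by
    rw [Finset.card_biUnion]
    · exact Finset.sum_congr rfl fun c _ => (Set.ncard_eq_toFinset_card' _).symm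
    · intro c _ c' _ hcc
      show Disjoint _ _
      rw [Finset.disjoint_left]
      intro e he he'
      exact hcc (eq_of_mem_monoEdges (by simpa using he) (by simpa using he'))
  have hsub : (hfin.toFinset.biUnion fun c => (H.monoEdges Φ x c).toFinset) ⊆
      {e | x ∈ H.inc e}.toFinset := by
    intro e he
    simp only [Finset.mem_biUnion, Set.mem_toFinset] at he ⊢
    obtain ⟨c, -, he⟩ := he
    exact he.1
  have hcard := Finset.card_le_card hsub
  have hdeg : H.degree x = {e | x ∈ H.inc e}.toFinset.card := Set.ncard_eq_toFinset_card' _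
  have hsum : r * hfin.toFinset.card ≤ ∑ c ∈ hfin.toFinset, (H.monoEdges Φ x c).ncard := by
    rw [mul_comm, ← smul_eq_mul]
    exact Finset.card_nsmul_le_sum _ _ _ fun c hc => hle c (by simpa using hc)
  constructor
  · intro c hc
    by_contra hne
    have hlt : ∑ _c ∈ hfin.toFinset, r < ∑ c ∈ hfin.toFinset, (H.monoEdges Φ x c).ncard :=
      Finset.sum_lt_sum (fun c hc => hle c (by simpa using hc))
        ⟨c, by simpa using hc, lt_of_le_of_ne (hle c hc) (Ne.symm hne)⟩
    rw [Finset.sum_const, smul_eq_mul, mul_comm] at hlt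
    omega
  · intro e he
    have heq := Finset.eq_of_subset_of_card_le hsub (by omega)
    have : e ∈ {e | x ∈ H.inc e}.toFinset := by simpa using he
    rw [← heq] at this
    simpa using this

/-- A partial coloring from the lists whose color classes are all in `good`. -/
structure IsPartialColoring (good : Set H.V → Prop) (L : H.V → Set C) (Φ : H.V → Option C) :
    Prop where
  mem_list : ∀ x c, Φ x = some c → c ∈ L x
  good_class : ∀ c, good (Φ ⁻¹' {some c})

theorem IsPartialColoring.of_le (hg : H.DegreeClosed r good) {Φ Ψ : H.V → Option C}
    (h : IsPartialColoring good L Φ) (hle : ∀ x c, Ψ x = some c → Φ x = some c) :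
    IsPartialColoring good L Ψ where
  mem_list x c hx := h.mem_list x c (hle x c hx)
  good_class c := hg.mono _ _ (fun x hx => hle x c hx) (h.good_class c)

theorem IsPartialColoring.update [DecidableEq H.V] (hg : H.DegreeClosed r good)
    {Φ : H.V → Option C} (h : IsPartialColoring good L Φ) {x : H.V} {c : C} (hc : c ∈ L x)
    (hlt : (H.monoEdges Φ x c).ncard < r) :
    IsPartialColoring good L (Function.update Φ x (some c)) where
  mem_list y c' hy := by
    by_cases hyx : y = x
    · subst hyx
      rw [update_self] at hy
      exact Option.some_injective _ hy ▸ hc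
    · rw [update_of_ne hyx] at hy
      exact h.mem_list y c' hy
  good_class c' := by
    by_cases hcc : c' = c
    · subst hcc
      refine hg.mono _ _ ?_ (hg.insert x _ (h.good_class c') ?_)
      · intro y hy
        by_cases hyx : y = x
        · exact Or.inl hyx
        · right
          have hy' : Function.update Φ x (some c') y = some c' := hy
          rwa [update_of_ne hyx] at hy'
      · refine lt_of_le_of_lt (Set.ncard_le_ncard ?_ (Set.toFinite _)) hlt
        intro e he
        exact ⟨he.1, fun y hy hyx => (he.2 hy).resolve_left hyx⟩
    · refine hg.mono _ _ ?_ (h.good_class c')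
      intro y hy
      have hy' : Function.update Φ x (some c) y = some c' := hy
      by_cases hyx : y = x
      · subst hyx
        rw [update_self] at hy'
        exact absurd (Option.some_injective _ hy').symm hcc
      · rwa [update_of_ne hyx] at hy'

/-- The partial colorings with at most one uncolored vertex. -/
def almostColorings (good : Set H.V → Prop) (L : H.V → Set C) : Set (H.V → Option C) :=
  {Φ | IsPartialColoring good L Φ ∧ ∀ x y, Φ x = none → Φ y = none → x = y}

/-- Color the vertices in order of decreasing distance from `w`. Each one still has a vacant
neighbor nearer to `w`, so not all its edges are monochromatic and some list color has fewer than
`r` monochromatic edges. -/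
theorem exists_almostColoring (hg : H.DegreeClosed r good) (hH : H.primal.Connected) (hr : 0 < r)
    (hL : ∀ x : H.V, (H.degree x : ℕ∞) ≤ (r : ℕ∞) * (L x).encard) (w : H.V) :
    ∃ Φ ∈ almostColorings good L, Φ w = none := by
  classical
  -- The greedy process as an extremal choice: the vacant set contains everything nearer to `w` than
  -- any of its members, and has minimum size.
  let T : Set (H.V → Option C) := {Φ | IsPartialColoring good L Φ ∧ Φ w = none ∧
    ∀ x y, Φ x = none → H.primal.dist w y < H.primal.dist w x → Φ y = none}
  have hT : T.Nonempty := by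
    refine ⟨fun _ => none, ⟨by simp, fun c => ?_⟩, rfl, fun _ _ _ _ => rfl⟩
    convert hg.empty using 1
    ext x
    simp
  obtain ⟨Φ, ⟨hΦ, hΦw, hdown⟩, hmin⟩ :=
    (measure fun Φ : H.V → Option C => {x | Φ x = none}.ncard).wf.has_min T hT
  suffices hall : ∀ x, Φ x = none → x = w from
    ⟨Φ, ⟨hΦ, fun x y hx hy => (hall x hx).trans (hall y hy).symm⟩, hΦw⟩
  by_contra! hne
  obtain ⟨x, ⟨hx, hxw⟩, hmax⟩ := Set.exists_max_image {x | Φ x = none ∧ x ≠ w}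
    (fun x => H.primal.dist w x) (Set.toFinite _) hne
  obtain ⟨y, hxy, hy⟩ : ∃ y, H.primal.Adj x y ∧ Φ y = none := by
    obtain ⟨P, hP⟩ := (hH.preconnected x w).exists_walk_length_eq_dist
    cases P with
    | nil => exact absurd rfl hxw
    | @cons _ y _ hadj Q =>
      refine ⟨y, hadj, hdown x y hx ?_⟩
      have := SimpleGraph.dist_le Q
      rw [SimpleGraph.Walk.length_cons] at hP
      rw [SimpleGraph.dist_comm, SimpleGraph.dist_comm (u := w) (v := x)]
      omega
  obtain ⟨c, hc, hlt⟩ : ∃ c ∈ L x, (H.monoEdges Φ x c).ncard < r := by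
    by_contra! hle
    obtain ⟨hne', e, hxe, hye⟩ := hxy
    obtain ⟨c, -, hc⟩ := (monoEdges_of_forall_le hr (hL x) hle).2 e hxe
    have := hc.2 y hye hne'.symm
    simp [hy] at this
  refine hmin (Function.update Φ x (some c)) ⟨hΦ.update hg hc hlt, ?_, ?_⟩ ?_
  · rwa [update_of_ne hxw.symm]
  · intro a b ha hab
    have hax : a ≠ x := by
      rintro rfl
      simp at ha
    rw [update_of_ne hax] at ha
    have hbx : b ≠ x := by
      rintro rfl
      by_cases haw : a = w
      · subst haw
        simp at hab
      · exact absurd hab (not_lt.2 (hmax a ⟨ha, haw⟩))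
    rw [update_of_ne hbx]
    exact hdown a b ha hab
  · refine Set.ncard_lt_ncard (Set.ssubset_iff_of_subset ?_ |>.2 ⟨x, hx, by simp⟩) (Set.toFinite _)
    intro a ha
    have hax : a ≠ x := by
      rintro rfl
      simp at ha
    rwa [Set.mem_ofPred_eq, update_of_ne hax] at ha

theorem le_ncard_monoEdges (hg : H.DegreeClosed r good)
    (hun : ∀ Φ, IsPartialColoring good L Φ → ∃ x, Φ x = none) {Φ : H.V → Option C}
    (hΦ : Φ ∈ almostColorings good L) {x : H.V} (hx : Φ x = none) (c : C) (hc : c ∈ L x) :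
    r ≤ (H.monoEdges Φ x c).ncard := by
  classical
  by_contra! hlt
  obtain ⟨y, hy⟩ := hun _ (hΦ.1.update hg hc hlt)
  have hyx : y ≠ x := by
    rintro rfl
    simp at hy
  rw [update_of_ne hyx] at hy
  exact hyx (hΦ.2 y x hy hx)

theorem ncard_monoEdges_eq (hg : H.DegreeClosed r good) (hr : 0 < r)
    (hL : ∀ x : H.V, (H.degree x : ℕ∞) ≤ (r : ℕ∞) * (L x).encard)
    (hun : ∀ Φ, IsPartialColoring good L Φ → ∃ x, Φ x = none) {Φ : H.V → Option C}
    (hΦ : Φ ∈ almostColorings good L) {x : H.V} (hx : Φ x = none) (c : C) :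
    (c ∈ L x → (H.monoEdges Φ x c).ncard = r) ∧ (c ∉ L x → (H.monoEdges Φ x c).ncard = 0) := by
  obtain ⟨h1, h2⟩ := monoEdges_of_forall_le hr (hL x) (le_ncard_monoEdges hg hun hΦ hx)
  refine ⟨h1 c, fun hc => ?_⟩
  rw [Set.ncard_eq_zero, Set.eq_empty_iff_forall_notMem]
  intro e he
  obtain ⟨c', hc', he'⟩ := h2 e he.1
  exact hc (eq_of_mem_monoEdges he he' ▸ hc')

/-- The almost complete colorings of an uncolorable hypergraph form a sliding system. -/
theorem monoSystem_almostColorings [DecidableEq H.V] (hg : H.DegreeClosed r good) (hr : 0 < r)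
    (hL : ∀ x : H.V, (H.degree x : ℕ∞) ≤ (r : ℕ∞) * (L x).encard)
    (hun : ∀ Φ, IsPartialColoring good L Φ → ∃ x, Φ x = none) :
    H.MonoSystem (almostColorings good L) where
  unique Φ hΦ := hΦ.2
  slide Φ hΦ x y hx hxy := by
    obtain ⟨h1, h2⟩ := monoEdges_of_forall_le hr (hL x) (le_ncard_monoEdges hg hun hΦ hx)
    obtain ⟨hne, e, hxe, hye⟩ := hxy
    obtain ⟨c, hc, he⟩ := h2 e hxe
    have hyc : Φ y = some c := he.2 y hye hne.symm
    have hΨ : IsPartialColoring good L (Function.update Φ y none) := hΦ.1.of_le hg fun z c' hz => by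
      by_cases hzy : z = y
      · subst hzy
        simp at hz
      · rwa [update_of_ne hzy] at hz
    -- Vacating `y` spoils the edge `e`, so the count for `c` at `x` drops from exactly `r` to below
    -- `r`, and `x` can take `c`.
    have hlt : (H.monoEdges (Function.update Φ y none) x c).ncard < r := by
      rw [← h1 c hc]
      refine Set.ncard_lt_ncard (Set.ssubset_iff_of_subset ?_ |>.2 ⟨e, he, fun he' => ?_⟩)
        (Set.toFinite _)
      · intro e' he'
        refine ⟨he'.1, fun z hz hzx => ?_⟩
        have := he'.2 z hz hzx
        by_cases hzy : z = y
        · subst hzy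
          simp at this
        · rwa [update_of_ne hzy] at this
      · have := he'.2 y hye hne.symm
        simp at this
    have heq : Φ ∘ Equiv.swap x y =
        Function.update (Function.update Φ y none) x (some c) := by
      funext z
      by_cases hzx : z = x
      · subst hzx
        simp [hyc]
      · rw [update_of_ne hzx, comp_apply]
        by_cases hzy : z = y
        · subst hzy
          simp [hx]
        · rw [update_of_ne hzy, Equiv.swap_apply_of_ne_of_ne hzx hzy]
    refine ⟨heq ▸ hΨ.update hg hc hlt, fun a b ha hb => ?_⟩
    exact (Equiv.swap x y).injective (hΦ.2 _ _ ha hb)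
  mono Φ hΦ x hx e he := by
    obtain ⟨c, -, hc⟩ :=
      (monoEdges_of_forall_le hr (hL x) (le_ncard_monoEdges hg hun hΦ hx)).2 e he
    exact ⟨c, hc⟩
  balanced Φ hΦ Ψ hΨ x hx hx' c := by
    obtain ⟨h1, h2⟩ := ncard_monoEdges_eq hg hr hL hun hΦ hx c
    obtain ⟨h3, h4⟩ := ncard_monoEdges_eq hg hr hL hun hΨ hx' c
    by_cases hc : c ∈ L x
    · rw [h1 hc, h3 hc]
    · rw [h2 hc, h4 hc]

/-! ### Restriction to a block -/

/-- The configurations on a block that arise from those configurations on the whole hypergraph that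
agree with `Φ₀` outside of the block. -/
def restrictSystem (B : H.Sub) (S : Set (H.V → Option C)) (Φ₀ : H.V → Option C) :
    Set (B.toHypergraph.V → Option C) :=
  {φ | ∃ Φ ∈ S, (∀ z, z ∉ B.verts → Φ z = Φ₀ z) ∧ ∀ z : B.toHypergraph.V, φ z = Φ z.1}

theorem ncard_monoEdges_toHypergraph (B : H.Sub) {Φ : H.V → Option C}
    {φ : B.toHypergraph.V → Option C} (hφ : ∀ z : B.toHypergraph.V, φ z = Φ z.1)
    (x : B.toHypergraph.V) (c : C) :
    (B.toHypergraph.monoEdges φ x c).ncard = (H.monoEdges Φ x.1 c ∩ B.edges).ncard := by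
  have himg : H.monoEdges Φ x.1 c ∩ B.edges = Subtype.val '' B.toHypergraph.monoEdges φ x c := by
    ext e
    constructor
    · rintro ⟨he, heB⟩
      exact ⟨⟨e, heB⟩, ⟨he.1, fun y hy hyx =>
        (hφ y).trans (he.2 y.1 hy fun h => hyx (Subtype.ext h))⟩, rfl⟩
    · rintro ⟨e, he, rfl⟩
      refine ⟨⟨he.1, fun y hy hyx => ?_⟩, e.2⟩
      have hyB := B.inc_subset e.1 e.2 hy
      exact (hφ ⟨y, hyB⟩).symm.trans
        (he.2 ⟨y, hyB⟩ hy fun h => hyx (congrArg (fun z : B.verts => z.1) h))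
  rw [himg]
  exact (Set.ncard_image_of_injective _ Subtype.val_injective).symm

theorem MonoSystem.restrict [DecidableEq H.V] {S : Set (H.V → Option C)} (h : H.MonoSystem S)
    {B : H.Sub} [DecidableEq B.toHypergraph.V] (hB : IsBlock B) (Φ₀ : H.V → Option C) :
    B.toHypergraph.MonoSystem (restrictSystem B S Φ₀) where
  unique := by
    rintro φ ⟨Φ, hΦ, -, hφ⟩ x y hx hy
    exact Subtype.ext (h.unique Φ hΦ _ _ ((hφ x).symm.trans hx) ((hφ y).symm.trans hy))
  slide := by
    rintro φ ⟨Φ, hΦ, hout, hφ⟩ x y hx ⟨hxy, e, hxe, hye⟩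
    refine ⟨_, h.slide Φ hΦ x.1 y.1 ((hφ x).symm.trans hx)
      ⟨fun he => hxy (Subtype.ext he), e.1, hxe, hye⟩, fun z hz => ?_, fun z => ?_⟩
    · rw [comp_apply, Equiv.swap_apply_of_ne_of_ne, hout z hz]
      · exact fun he => hz (he ▸ x.2)
      · exact fun he => hz (he ▸ y.2)
    · show φ (Equiv.swap x y z) = Φ (Equiv.swap x.1 y.1 z.1)
      rw [hφ]
      congr 1
      by_cases hzx : z = x
      · subst hzx
        simp
      · by_cases hzy : z = y
        · subst hzy
          simp
        · rw [Equiv.swap_apply_of_ne_of_ne hzx hzy,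
            Equiv.swap_apply_of_ne_of_ne (fun he => hzx (Subtype.ext he))
              (fun he => hzy (Subtype.ext he))]
  mono := by
    rintro φ ⟨Φ, hΦ, -, hφ⟩ x hx e hxe
    obtain ⟨c, hc⟩ := h.mono Φ hΦ x.1 ((hφ x).symm.trans hx) e.1 hxe
    exact ⟨c, hxe, fun y hy hyx => (hφ y).trans (hc.2 y.1 hy fun he => hyx (Subtype.ext he))⟩
  balanced := by
    rintro φ ⟨Φ, hΦ, hΦout, hφ⟩ ψ ⟨Ψ, hΨ, hΨout, hψ⟩ x hx hx' c
    rw [ncard_monoEdges_toHypergraph B hφ, ncard_monoEdges_toHypergraph B hψ]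
    have h1 := h.balanced Φ hΦ Ψ hΨ x.1 ((hφ x).symm.trans hx) ((hψ x).symm.trans hx') c
    rw [← Set.ncard_inter_add_ncard_sdiff_eq_ncard _ B.edges (Set.toFinite _),
      ← Set.ncard_inter_add_ncard_sdiff_eq_ncard (H.monoEdges Ψ x.1 c) B.edges (Set.toFinite _)] at h1
    -- An edge at `x` outside the block has no other vertex in it, so its values are those of the
    -- frozen `Φ₀` and it contributes equally to both counts.
    have h2 : H.monoEdges Φ x.1 c \ B.edges = H.monoEdges Ψ x.1 c \ B.edges := by
      ext e
      refine and_congr_left fun heB => and_congr_right fun hxe => ?_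
      refine forall_congr' fun y => forall_congr' fun hye => forall_congr' fun hyx => ?_
      have hyB : y ∉ B.verts := fun hyB => heB (hB.mem_edges hyx hyB x.2 hye hxe)
      rw [hΦout y hyB, hΨout y hyB]
    rw [h2] at h1
    exact Nat.add_right_cancel h1

theorem isBrick_of_isEmpty_edges (K : MultiHypergraph.{u}) [IsEmpty K.E] (hK : K.primal.Connected) :
    K.IsBrick := by
  have := hK.nonempty
  refine K.isBrick_of_primal one_pos (fun e => isEmptyElim e)
    (fun x y hxy => isEmptyElim hxy.2.choose) (Or.inl ?_)
  ext x y
  rw [SimpleGraph.top_adj]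
  refine ⟨fun h => h.ne, fun hxy => ?_⟩
  obtain ⟨W⟩ := hK.preconnected x y
  cases W with
  | nil => exact absurd rfl hxy
  | cons hadj _ => exact isEmptyElim hadj.2.choose

theorem isEmpty_edges_of_degree_eq_zero (h : ∀ x : H.V, H.degree x = 0) : IsEmpty H.E := by
  refine ⟨fun e => ?_⟩
  obtain ⟨x, hx⟩ := Set.nonempty_of_ncard_ne_zero (by have := H.two_le_inc e; omega :
    (H.inc e).ncard ≠ 0)
  have h0 := h x
  rw [degree, Set.ncard_eq_zero] at h0
  exact (Set.eq_empty_iff_forall_notMem.1 h0 e) hx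

/-- If all almost complete colorings are constant on a block, then the block is in `P` and has maximum
degree at most `r`, or it is an `r`-regular hypergraph of `F(P)`. -/
theorem IsBlock.mem_or_mem_of_const {P : HypergraphProperty.{u}} (hP : P.Hereditary) {B : H.Sub}
    (hB : IsBlock B) (hr : r = P.d) {c : C}
    (hc : ∀ x ∈ B.verts, ∃ Φ : H.V → Option C, H.induce (Φ ⁻¹' {some c}) ∈ P.carrier ∧
      (H.monoEdges Φ x c).ncard ≤ r ∧ ∀ y ∈ B.verts, y ≠ x → Φ y = some c) :
    (B.toHypergraph ∈ P.forbidden ∧ B.toHypergraph.IsRegular r) ∨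
      (B.toHypergraph ∈ P.carrier ∧ B.toHypergraph.maxDegree ≤ r) := by
  have : Nonempty B.toHypergraph.V := hB.primal_connected.nonempty
  have hdeg : ∀ x, B.toHypergraph.degree x ≤ r := by
    intro x
    obtain ⟨Φ, -, hle, hΦ⟩ := hc x.1 x.2
    refine le_trans ?_ hle
    rw [degree_toHypergraph]
    refine Set.ncard_le_ncard ?_ (Set.toFinite _)
    rintro e ⟨hx, he⟩
    exact ⟨hx, fun y hy hyx => hΦ y (B.inc_subset e he hy) hyx⟩
  by_cases hmem : B.toHypergraph ∈ P.carrier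
  · exact Or.inr ⟨hmem, ciSup_le hdeg⟩
  · have hforb : B.toHypergraph ∈ P.forbidden := by
      refine ⟨hmem, fun x => ?_⟩
      obtain ⟨Φ, hgood, -, hΦ⟩ := hc x.1 x.2
      have key := hP.induce_mono (X := B.verts \ {x.1}) (fun y hy => hΦ y hy.1 hy.2) hgood
      -- `B` is replaced by the subhypergraph induced on its vertices; the type of `x` depends on
      -- `B`.
      revert x
      rw [hB.eq_inducedSub]
      intro x _ key
      exact HypergraphProperty.induce_deleteVertex_mem B.verts x key
    refine Or.inl ⟨hforb, this, fun x => le_antisymm (hdeg x) ?_⟩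
    rw [hr]
    exact (HypergraphProperty.d_le_minDegree hforb).trans (B.toHypergraph.minDegree_le_degree x)

end MultiHypergraph

/-! ### The theorem -/

open MultiHypergraph in
theorem theorem1p6 (P : HypergraphProperty.{u}) (hnt : P.NonTrivial) (hher : P.Hereditary)
    (hadd : P.Additive) (r : ℕ) (hr : P.d = r)
    (H : MultiHypergraph.{u}) (hH : H.Connected)
    {C : Type w} (L : H.V → Set C)
    (hL : ∀ x : H.V, (H.degree x : ℕ∞) ≤ (r : ℕ∞) * (L x).encard) :
    P.ListColorable H L ∨
      ∀ B : H.Sub, MultiHypergraph.IsBlock B →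
        B.toHypergraph.IsBrick ∨
        (B.toHypergraph ∈ P.forbidden ∧ B.toHypergraph.IsRegular r) ∨
        (B.toHypergraph ∈ P.carrier ∧ B.toHypergraph.maxDegree ≤ r) := by
  classical
  have hex : ∃ K, K ∈ P.carrier := hnt.1.imp fun _ h => h.1
  have hg := hher.degreeClosed hex H
  rw [hr] at hg
  by_cases hcol : ∃ Φ : H.V → Option C,
      IsPartialColoring (fun X => H.induce X ∈ P.carrier) L Φ ∧ ∀ x, Φ x ≠ none
  · left
    obtain ⟨Φ, hΦ, hsome⟩ := hcol
    choose φ hφ using fun x => Option.ne_none_iff_exists'.1 (hsome x)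
    refine ⟨φ, fun x => hΦ.mem_list x _ (hφ x), fun c => ?_⟩
    have hpre : φ ⁻¹' {c} = Φ ⁻¹' {some c} := by
      ext x
      simp [hφ]
    exact hpre ▸ hΦ.good_class c
  right
  intro B hB
  have hcon := hB.primal_connected
  -- For `r = 0` all degrees vanish, so the connected block has no edges and is `K_1`.
  rcases Nat.eq_zero_or_pos r with hr0 | hr0
  · left
    have hE := isEmpty_edges_of_degree_eq_zero (H := H) fun x => by
      have := hL x
      simpa [hr0] using this
    have : IsEmpty B.toHypergraph.E := ⟨fun e => hE.false e.1⟩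
    exact isBrick_of_isEmpty_edges _ hcon
  have hun : ∀ Φ, IsPartialColoring (fun X => H.induce X ∈ P.carrier) L Φ → ∃ x, Φ x = none := by
    intro Φ hΦ
    by_contra! h
    exact hcol ⟨Φ, hΦ, h⟩
  obtain ⟨x₀⟩ := hcon.nonempty
  obtain ⟨Φ₀, hΦ₀, hx₀⟩ := exists_almostColoring hg (connected_iff_primal.1 hH) hr0 hL x₀.1
  have hsys := monoSystem_almostColorings hg hr0 hL hun
  have hres := hsys.restrict hB Φ₀
  have hmem₀ : (fun z : B.toHypergraph.V => Φ₀ z.1) ∈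
      restrictSystem B (almostColorings (fun X => H.induce X ∈ P.carrier) L) Φ₀ :=
    ⟨Φ₀, hΦ₀, fun _ _ => rfl, fun _ => rfl⟩
  rcases hres.isBrick_or_const hcon.preconnected hB.primal_compl_preconnected
    ⟨_, hmem₀, x₀, hx₀⟩ with h | ⟨c, hc⟩
  · exact Or.inl h
  refine Or.inr (hB.mem_or_mem_of_const hher hr.symm (c := c) fun x hx => ?_)
  -- Every vertex of the block can be made the vacant one by sliding within the block, and the rest
  -- of the block then has the color `c`.
  obtain ⟨φ, hφS, hφx⟩ := hres.exists_slide_to hcon.preconnected hmem₀ hx₀ ⟨x, hx⟩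
  obtain ⟨Φ, hΦ, -, hφ⟩ := id hφS
  have hΦx : Φ x = none := (hφ ⟨x, hx⟩).symm.trans hφx
  refine ⟨Φ, hΦ.1.good_class c, ?_, fun y hy hyx => ?_⟩
  · obtain ⟨h1, h2⟩ := ncard_monoEdges_eq hg hr0 hL hun hΦ hΦx c
    by_cases hcx : c ∈ L x
    · exact (h1 hcx).le
    · rw [h2 hcx]
      exact Nat.zero_le _
  · rw [← hc φ hφS ⟨x, hx⟩ ⟨y, hy⟩ hφx fun he => hyx (congrArg (fun z : B.verts => z.1) he)]
    exact (hφ ⟨y, hy⟩).symm
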